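/- Consider the system $x_{t+1}=Ax_t+Bu_t$, $y_t=Cx_t$ with $A\in\mathbb{R}^{n\times n}$, $B\in\mathbb{R}^{n\times m}$ and $C\in\mathbb{R}^{d\times n}$ of full row rank, positive definite weights $Q\in\mathbb{R}^{n\times n}$, $R\in\mathbb{R}^{m\times m}$, and a random initial state $x_0\sim\mathcal{D}$ with finite second moments. Throughout, $\|\cdot\|$ is the spectral norm, $\|\cdot\|_F$ the Frobenius norm, $\rho$ the spectral radius, and $\sigma_{\min}$, $\lambda_{\min}$ denote the smallest singular value and the smallest eigenvalue. Put $\mathbb{K}=\{K\in\mathbb{R}^{m\times d}:\rho(A-BKC)<1\}$ and, for $K\in\mathbb{K}$, $$J(K)=\mathbb{E}_{x_0\sim\mathcal{D}}\Big[\sum_{t=0}^\infty (x_t^\top Qx_t+u_t^\top Ru_t)\Big],\qquad u_t=-Ky_t .$$ Let $\mathbb{K}_a=\{K\in\mathbb{K}:J(K)\le a\}$ and $\mathbb{K}^o_a=\{K\in\mathbb{K}:J(K)<a\}$. Let $\mu=\sigma_{\min}(\mathbb{E}[x_0x_0^\top])$ and assume $\mu>0$. For $\alpha\in\mathbb{R}$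 define $\gamma=\max_{K\in\mathbb{K}_\alpha}\|A-BKC\|$ and $$\zeta_1=\frac{1}{\sigma_{\min}(Q)}\Big((1+\|C\|^2\|B\|^2)\frac{\alpha}{\mu}+\|C\|^2\|R\|\Big)-1,$$ $$L=2\|C\|^2\Big(\|R\|+\|B\|^2\Big(1+\frac{2\zeta_1}{\|C\|\|B\|}\Big)\frac{\alpha}{\mu}\Big)\frac{\alpha}{\sigma_{\min}(Q)},$$ $$q_3=\frac{\sqrt{\|R\|\alpha+\|B\|^2\alpha^2/\mu}}{\sqrt{\mu}\,\sigma_{\min}(R)}+\frac{\|B\|\|A\|\alpha}{\mu\,\sigma_{\min}(R)},$$ $$\zeta_2=\frac{2}{\sigma_{\min}(Q)}\Big(\|C\|\|R\|q_3+\gamma\|C\|\|B\|\frac{\alpha}{\mu}\Big),$$ $$\zeta_3=\frac{2}{\sigma_{\min}(Q)}\Big(\|C\|^2\|R\|+\|C\|\|B\|\big(\|C\|\|B\|+\zeta_1\gamma+\zeta_2\gamma\big)\frac{\alpha}{\mu}\Big),$$ $$\zeta_4=\frac{2}{\sigma_{\min}(Q)}\Big(\|C\|^2\|R\|+\|C\|\|B\|\big(\|C\|\|B\|+\zeta_1\gamma\big)\frac{\alpha}{\mu}\Big),$$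 $$M=\frac{2\alpha^2}{\mu\,\sigma_{\min}(Q)}\|B\|\|C\|\big((2\zeta_1+\zeta_2)\|B\|\|C\|+2\zeta_3+\zeta_4\big).$$ Let $\beta<\alpha$, and let $\omega=\inf\{\|K-K'\|_F: K\in\mathbb{K}_\beta,\ K'\in\mathbb{R}^{m\times d}\setminus\mathbb{K}^o_\alpha\}$. Let $K^\ddag\in\mathbb{K}_\beta$ be a local minimum of $J$ on $\mathbb{K}$ with $l=\lambda_{\min}(\nabla^2J(\mathrm{vec}(K^\ddag)))>0$, and (when $B\neq0$, so that $M>0$) set $\bar r=2l/M$. Let $0<\eta\le 1/L$, let $K_0\in\mathbb{R}^{m\times d}$ and $K_{i+1}=K_i-\eta\nabla J(K_i)$ for $i\ge0$. If $r_0=\|K_0-K^\ddag\|_F<\bar r$ and $\bar r r_0/(\bar r-r_0)\le\omega$, then for every $i\ge0$ the iterate $K_i$ lies in $\mathbb{K}$ and $$\|K_i-K^\ddag\|_F\le\frac{\bar r r_0}{\bar r-r_0}\Big(\frac{1}{1+\eta l}\Big)^i .$$ -/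

import Mathlib

open MeasureTheory
open scoped Matrix Matrix.Norms.Frobenius ENNReal

noncomputable section

/-- The spectral norm of a real matrix. (The norm `‖·‖` on matrices in this file is the
Frobenius norm.) -/
def specNorm {p q : ℕ} (X : Matrix (Fin p) (Fin q) ℝ) : ℝ :=
  ‖LinearMap.toContinuousLinearMap (Matrix.toEuclideanLin X)‖

/-- The minimal singular value of a square matrix: the last of its `p` singular values, which
Mathlib lists in decreasing order, starting at index `0`. -/
def sigmaMin {p : ℕ} (X : Matrix (Fin p) (Fin p) ℝ) : ℝ :=
  (Matrix.toEuclideanLin X).singularValues (p - 1)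

/-- The minimal eigenvalue of a real symmetric matrix. -/
def lambdaMin {ι : Type} [Fintype ι] [DecidableEq ι] (X : Matrix ι ι ℝ) : ℝ :=
  sInf (spectrum ℝ X)

/-- The distance between two sets of matrices, for the Frobenius norm. -/
def setDist {p q : ℕ} (S T : Set (Matrix (Fin p) (Fin q) ℝ)) : ℝ≥0∞ :=
  ⨅ X ∈ S, ⨅ Y ∈ T, ENNReal.ofReal ‖X - Y‖

/-- The matrix `∇F(K)` of the partial derivatives of a function of a matrix. -/
def matrixGradient {m d : ℕ} (F : Matrix (Fin m) (Fin d) ℝ → ℝ)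
    (K : Matrix (Fin m) (Fin d) ℝ) : Matrix (Fin m) (Fin d) ℝ :=
  Matrix.of fun i j => fderiv ℝ F K (Matrix.single i j 1)

/-- The Hessian matrix `∇²F(vec K)` of the second partial derivatives of a function of a matrix;
the entries of `vec K` are indexed by the positions `(i, j)`. -/
def matrixHessian {m d : ℕ} (F : Matrix (Fin m) (Fin d) ℝ → ℝ)
    (K : Matrix (Fin m) (Fin d) ℝ) : Matrix (Fin m × Fin d) (Fin m × Fin d) ℝ :=
  Matrix.of fun p q =>
    fderiv ℝ (fun K' => fderiv ℝ F K' (Matrix.single q.1 q.2 1)) K (Matrix.single p.1 p.2 1)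

/-- The data of a static output feedback problem: the system `x_{t+1} = A x_t + B u_t`,
`y_t = C x_t`, the cost weights `Q` and `R`, and the law `D` of the initial state. -/
structure SOF (n m d : ℕ) where
  A : Matrix (Fin n) (Fin n) ℝ
  B : Matrix (Fin n) (Fin m) ℝ
  C : Matrix (Fin d) (Fin n) ℝ
  Q : Matrix (Fin n) (Fin n) ℝ
  R : Matrix (Fin m) (Fin m) ℝ
  D : Measure (Fin n → ℝ)

namespace SOF

variable {n m d : ℕ} (S : SOF n m d)

/-- The input `u = -K y = -K C x`. -/
def input (K : Matrix (Fin m) (Fin d) ℝ) (x : Fin n → ℝ) : Fin m → ℝ :=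
  -(K *ᵥ (S.C *ᵥ x))

/-- The state `x_t` under the feedback `u_t = -K y_t`, started at `x₀`. -/
def state (K : Matrix (Fin m) (Fin d) ℝ) (x₀ : Fin n → ℝ) : ℕ → Fin n → ℝ
  | 0 => x₀
  | t + 1 => S.A *ᵥ state K x₀ t + S.B *ᵥ S.input K (state K x₀ t)

/-- The stage cost `xᵀ Q x + uᵀ R u` with `u = -K C x`. -/
def stageCost (K : Matrix (Fin m) (Fin d) ℝ) (x : Fin n → ℝ) : ℝ :=
  x ⬝ᵥ (S.Q *ᵥ x) + S.input K x ⬝ᵥ (S.R *ᵥ S.input K x)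

/-- The cost `J(K)`, the expectation of the sum of all stage costs. It is only used at
stabilizing `K`, where the series converges and its sum is integrable. -/
def J (K : Matrix (Fin m) (Fin d) ℝ) : ℝ :=
  ∫ x₀, ∑' t : ℕ, S.stageCost K (S.state K x₀ t) ∂S.D

/-- The closed-loop matrix `A - B K C`. -/
def closedLoop (K : Matrix (Fin m) (Fin d) ℝ) : Matrix (Fin n) (Fin n) ℝ :=
  S.A - S.B * K * S.C

/-- The set of stabilizing gains `K`, those with spectral radius `ρ(A - B K C) < 1`. -/
def stabilizing : Set (Matrix (Fin m) (Fin d) ℝ) :=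
  {K | spectralRadius ℂ ((S.closedLoop K).map (algebraMap ℝ ℂ)) < 1}

/-- The sublevel set of the stabilizing `K` with `J(K) ≤ a`. -/
def sublevel (a : ℝ) : Set (Matrix (Fin m) (Fin d) ℝ) :=
  {K | K ∈ S.stabilizing ∧ S.J K ≤ a}

/-- The strict sublevel set of the stabilizing `K` with `J(K) < a`. -/
def strictSublevel (a : ℝ) : Set (Matrix (Fin m) (Fin d) ℝ) :=
  {K | K ∈ S.stabilizing ∧ S.J K < a}

/-- The second moment matrix `X₀ = E[x₀ x₀ᵀ]` of the initial state. -/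
def X0 : Matrix (Fin n) (Fin n) ℝ :=
  Matrix.of fun i j => ∫ x, x i * x j ∂S.D

/-- `μ`, the minimal singular value of `X₀`. -/
def mu : ℝ := sigmaMin S.X0

/-- The constant `ζ₁`. -/
def zeta1 (α : ℝ) : ℝ :=
  1 / sigmaMin S.Q *
    ((1 + specNorm S.C ^ 2 * specNorm S.B ^ 2) * (α / S.mu) + specNorm S.C ^ 2 * specNorm S.R) - 1

/-- The smoothness constant `L`. -/
def smoothConst (α : ℝ) : ℝ :=
  2 * specNorm S.C ^ 2 *
    (specNorm S.R +
      specNorm S.B ^ 2 * (1 + 2 * S.zeta1 α / (specNorm S.C * specNorm S.B)) * (α / S.mu)) *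
    (α / sigmaMin S.Q)

/-- The constant `q₃`. -/
def q3 (α : ℝ) : ℝ :=
  √(specNorm S.R * α + specNorm S.B ^ 2 * α ^ 2 / S.mu) / (√S.mu * sigmaMin S.R) +
    specNorm S.B * specNorm S.A * α / (S.mu * sigmaMin S.R)

/-- The constant `γ`, the maximum of `‖A - B K C‖` (spectral norm) over the sublevel set. -/
def gamma (α : ℝ) : ℝ :=
  sSup ((fun K => specNorm (S.closedLoop K)) '' S.sublevel α)

/-- The constant `ζ₂`. -/
def zeta2 (α : ℝ) : ℝ :=
  2 / sigmaMin S.Q *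
    (specNorm S.C * specNorm S.R * S.q3 α +
      S.gamma α * specNorm S.C * specNorm S.B * (α / S.mu))

/-- The constant `ζ₃`. -/
def zeta3 (α : ℝ) : ℝ :=
  2 / sigmaMin S.Q *
    (specNorm S.C ^ 2 * specNorm S.R +
      specNorm S.C * specNorm S.B *
        (specNorm S.C * specNorm S.B + S.zeta1 α * S.gamma α + S.zeta2 α * S.gamma α) *
        (α / S.mu))

/-- The constant `ζ₄`. -/
def zeta4 (α : ℝ) : ℝ :=
  2 / sigmaMin S.Q *
    (specNorm S.C ^ 2 * specNorm S.R +
      specNorm S.C * specNorm S.B *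
        (specNorm S.C * specNorm S.B + S.zeta1 α * S.gamma α) * (α / S.mu))

/-- The Lipschitz constant `M` of the Hessian. -/
def hessianLipConst (α : ℝ) : ℝ :=
  2 * α ^ 2 / (S.mu * sigmaMin S.Q) * specNorm S.B * specNorm S.C *
    ((2 * S.zeta1 α + S.zeta2 α) * specNorm S.B * specNorm S.C + 2 * S.zeta3 α + S.zeta4 α)

end SOF

end

open Filter Topology
open scoped ContDiff

/-! The cost is `J(K) = tr(P_K X₀)`, where the form `P_K` solves the Lyapunov equation of the closed
loop `A - BKC` with right side `Q + (KC)ᵀR(KC)`. The Lyapunov operator of a stable map is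
invertible, so `P_K` is smooth in `K`. Differentiating the equation shows that the directional
derivatives of `P_K` solve equations with the same operator, whose right sides involve only lower
derivatives.

Everything then rests on a comparison principle (`PowStable.abs_le`): if `|X - X(A·,A·)| ≤ Y -
Y(A·,A·)` on the diagonal and `A` is stable, then `|X| ≤ Y`. With `Y` built from `P_K`, each
derivative of `P_K` is bounded by a multiple of `P_K`. On the sublevel set `P_K ≤ α/μ`
(`SOF.mu_mul_le_moment`), so these multiples are uniform; taking second moments bounds the second
and third derivatives of `J` by `L` and `M`. The first derivative has two bounds, through `ζ₁` and
through `ζ₂`, and the stated `M` follows from using both of them (`SOF.le_hessianLipConst`).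

Since `r₀ ≤ r̄r₀/(r̄-r₀) ≤ ω`, the closed `r₀`-ball about the minimum lies in the strict
`α`-sublevel set. There the Hessian is at least `l - M‖x - x₀‖` and at most `L`, so a step with `ηL
≤ 1` multiplies the error `e` by at most `1 - ηl + ηMe/2` (`IsDescentRegion.norm_step_le`). In the
variable `a = e/r̄` this factor is `1 - ηl(1-a)`, and then `a/(1-a)` shrinks by `1/(1+ηl)` at each
step (`div_one_sub_contract`), while the iterates stay in the ball. -/

/-- Continuous bilinear forms on a real normed space. -/
abbrev BilForm (V : Type*) [NormedAddCommGroup V] [NormedSpace ℝ V] := V →L[ℝ] V →L[ℝ] ℝ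

/-! ### Comparison principle for Lyapunov equations of stable maps -/

section Forms

variable {V : Type*} [NormedAddCommGroup V] [NormedSpace ℝ V]

/-- The powers of `A` tend to zero pointwise. -/
def PowStable (A : V →L[ℝ] V) : Prop := ∀ v, Tendsto (fun k : ℕ => (A ^ k) v) atTop (𝓝 0)

/-- A form which is symmetric and positive semidefinite. -/
structure BilForm.IsPSD (X : BilForm V) : Prop where
  symm : ∀ u v, X u v = X v u
  nonneg : ∀ v, 0 ≤ X v v

/-- Nonnegativity at `s u ± v`, divided by `s`. The free weight `s` is what distinguishes the three
later bounds on the first derivative. -/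
lemma BilForm.IsPSD.two_mul_abs_le {X : BilForm V} (hX : X.IsPSD) (u v : V) {s : ℝ} (hs : 0 < s) :
    2 * |X u v| ≤ s * X u u + s⁻¹ * X v v := by
  have h1 := hX.nonneg (s • u - v)
  have h2 := hX.nonneg (s • u + v)
  simp only [map_sub, map_add, map_smul, _root_.sub_apply,
    _root_.add_apply, _root_.smul_apply, smul_eq_mul, hX.symm v u]
    at h1 h2
  have e : s * (s * X u u + s⁻¹ * X v v) = s * s * X u u + X v v := by field_simp
  have : s * (2 * |X u v|) ≤ s * (s * X u u + s⁻¹ * X v v) := by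
    rw [e]
    rcases abs_cases (X u v) with ⟨h, _⟩ | ⟨h, _⟩ <;> rw [h] <;> linarith
  exact le_of_mul_le_mul_left this hs

lemma PowStable.tendsto_apply {A : V →L[ℝ] V} (hA : PowStable A) (X : BilForm V) (u v : V) :
    Tendsto (fun k : ℕ => X ((A ^ k) u) ((A ^ k) v)) atTop (𝓝 0) := by
  have hc : Continuous (fun p : V × V => X p.1 p.2) := by fun_prop
  have := (hc.tendsto (0, 0)).comp ((hA u).prodMk_nhds (hA v))
  simpa [Function.comp_def] using this

/-- Iterating the identity replaces `u, v` by `Aᵏu, Aᵏv`, which tend to zero. This is uniqueness for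
the Lyapunov equation. -/
lemma PowStable.eq_zero {A : V →L[ℝ] V} (hA : PowStable A) {X : BilForm V}
    (h : ∀ u v, X u v = X (A u) (A v)) : X = 0 := by
  ext u v
  have : ∀ k : ℕ, X ((A ^ k) u) ((A ^ k) v) = X u v := by
    intro k
    induction k with
    | zero => simp
    | succ k ih => rw [pow_succ', ← ih]; exact (h _ _).symm
  have h2 := hA.tendsto_apply X u v
  simp only [this] at h2
  simpa using tendsto_nhds_unique tendsto_const_nhds h2

lemma PowStable.nonneg {A : V →L[ℝ] V} (hA : PowStable A) {X : BilForm V}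
    (h : ∀ v, X (A v) (A v) ≤ X v v) (v : V) : 0 ≤ X v v := by
  have : ∀ k : ℕ, X ((A ^ k) v) ((A ^ k) v) ≤ X v v := by
    intro k
    induction k with
    | zero => simp
    | succ k ih => rw [pow_succ']; exact (h _).trans ih
  exact le_of_tendsto (hA.tendsto_apply X v v) (Eventually.of_forall this)

/-- Both `Y - X` and `Y + X` decrease along the orbits of `A` and tend to zero there, hence are
nonnegative. All derivative bounds are instances of this. -/
lemma PowStable.abs_le {A : V →L[ℝ] V} (hA : PowStable A) {X Y : BilForm V}
    (h : ∀ v, |X v v - X (A v) (A v)| ≤ Y v v - Y (A v) (A v)) (v : V) : |X v v| ≤ Y v v := by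
  have h1 := hA.nonneg (X := Y - X) (fun v => by
    have := (_root_.abs_le.1 (h v)).2
    simp only [_root_.sub_apply]; linarith) v
  have h2 := hA.nonneg (X := Y + X) (fun v => by
    have := (_root_.abs_le.1 (h v)).1
    simp only [_root_.add_apply]; linarith) v
  simp only [_root_.sub_apply, _root_.add_apply] at h1 h2
  exact _root_.abs_le.2 ⟨by linarith, by linarith⟩

end Forms

/-! ### Bounds on solutions of Lyapunov equations by multiples of `P` -/

section Lyapunov

variable {V U : Type*} [NormedAddCommGroup V] [InnerProductSpace ℝ V]
  [NormedAddCommGroup U] [NormedSpace ℝ U]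

lemma BilForm.abs_apply_le {X : BilForm V} (hX : ∀ u v, X u v = X v u) {s : ℝ}
    (h : ∀ v, |X v v| ≤ s * ‖v‖ ^ 2) (u v : V) : |X u v| ≤ s * (‖u‖ * ‖v‖) := by
  rcases eq_or_ne u 0 with rfl | hu
  · simp
  rcases eq_or_ne v 0 with rfl | hv
  · simp
  have hu' : 0 < ‖u‖ := norm_pos_iff.2 hu
  have hv' : 0 < ‖v‖ := norm_pos_iff.2 hv
  -- Polarization after rescaling both vectors to the common norm `‖u‖‖v‖`, so that the
  -- parallelogram law gives the product of norms instead of a sum of squares.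
  have key : 4 * |X (‖v‖ • u) (‖u‖ • v)| ≤ s * (4 * (‖u‖ * ‖v‖) ^ 2) := by
    have h1 := h (‖v‖ • u + ‖u‖ • v)
    have h2 := h (‖v‖ • u - ‖u‖ • v)
    have hp := parallelogram_law_with_norm ℝ (‖v‖ • u) (‖u‖ • v)
    have e : 4 * X (‖v‖ • u) (‖u‖ • v) = X (‖v‖ • u + ‖u‖ • v) (‖v‖ • u + ‖u‖ • v)
        - X (‖v‖ • u - ‖u‖ • v) (‖v‖ • u - ‖u‖ • v) := by
      simp only [map_sub, map_add, map_smul, _root_.sub_apply,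
        _root_.add_apply, _root_.smul_apply, smul_eq_mul, hX v u]
      ring
    rw [show (4 : ℝ) * |X (‖v‖ • u) (‖u‖ • v)| = |4 * X (‖v‖ • u) (‖u‖ • v)| by
      rw [abs_mul]; norm_num, e]
    refine (abs_sub _ _).trans ?_
    calc _ ≤ s * ‖‖v‖ • u + ‖u‖ • v‖ ^ 2 + s * ‖‖v‖ • u - ‖u‖ • v‖ ^ 2 := add_le_add h1 h2
      _ = s * (‖‖v‖ • u + ‖u‖ • v‖ ^ 2 + ‖‖v‖ • u - ‖u‖ • v‖ ^ 2) := by ring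
      _ = _ := by rw [hp, norm_smul, norm_smul, norm_norm, norm_norm]; ring
  have e2 : X (‖v‖ • u) (‖u‖ • v) = (‖u‖ * ‖v‖) * X u v := by
    simp only [map_smul, _root_.smul_apply, smul_eq_mul]; ring
  rw [e2, abs_mul, abs_of_pos (mul_pos hu' hv')] at key
  have hpos := mul_pos hu' hv'
  refine le_of_mul_le_mul_left (?_ : (‖u‖ * ‖v‖) * _ ≤ (‖u‖ * ‖v‖) * _) hpos
  nlinarith

/-- The inner product as a bilinear form. -/
noncomputable def innerForm (V : Type*) [NormedAddCommGroup V] [InnerProductSpace ℝ V] :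
    BilForm V :=
  LinearMap.mkContinuous₂ (innerₗ V) 1 fun u v => by
    rw [one_mul, innerₗ_apply_apply]; exact norm_inner_le_norm u v

lemma innerForm_apply (u v : V) : innerForm V u v = inner ℝ u v := rfl

lemma innerForm_apply_self (v : V) : innerForm V v v = ‖v‖ ^ 2 := real_inner_self_eq_norm_sq v

/-- `P` solves the Lyapunov equation of the stable map `A` with right side `Q + GᵀRG`, with
`σ ≤ Q` and `P ≤ π`. -/
structure IsLyapunov (A : V →L[ℝ] V) (P Q : BilForm V) (R : BilForm U) (G : V →L[ℝ] U)
    (σ π : ℝ) : Prop where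
  stable : PowStable A
  pos : 0 < σ
  le : ∀ v, σ * ‖v‖ ^ 2 ≤ Q v v
  psdR : R.IsPSD
  symm : ∀ u v, P u v = P v u
  eq : ∀ u v, P u v - P (A u) (A v) = Q u v + R (G u) (G v)
  le_pi : ∀ v, P v v ≤ π * ‖v‖ ^ 2

/-- Bounds on a direction: `N` perturbs the feedback and `Z` the closed loop. -/
structure IsDirBound (R : BilForm U) (N : V →L[ℝ] U) (Z : V →L[ℝ] V) (c κ : ℝ) : Prop where
  feed : ∀ v, R (N v) (N v) ≤ c * ‖v‖ ^ 2
  loop : ∀ v, ‖Z v‖ ≤ κ * ‖v‖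

namespace IsLyapunov

variable {A : V →L[ℝ] V} {P Q : BilForm V} {R : BilForm U} {G : V →L[ℝ] U} {σ π : ℝ}

lemma decrease (h : IsLyapunov A P Q R G σ π) (v : V) :
    σ * ‖v‖ ^ 2 ≤ P v v - P (A v) (A v) := by
  have h1 := h.eq v v
  have h2 := h.le v
  have h3 := h.psdR.nonneg (G v)
  linarith

lemma psd (h : IsLyapunov A P Q R G σ π) : P.IsPSD where
  symm := h.symm
  nonneg := h.stable.nonneg fun v => by
    have h1 := h.decrease v
    have h2 : 0 ≤ σ * ‖v‖ ^ 2 := mul_nonneg h.pos.le (by positivity)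
    linarith

lemma le_self (h : IsLyapunov A P Q R G σ π) (v : V) : Q v v + R (G v) (G v) ≤ P v v := by
  have := h.eq v v
  have := h.psd.nonneg (A v)
  linarith

lemma sigma_le_pi [Nontrivial V] (h : IsLyapunov A P Q R G σ π) : σ ≤ π := by
  obtain ⟨v, hv⟩ := exists_ne (0 : V)
  have h1 := h.le_self v
  have h2 := h.le v
  have h3 := h.psdR.nonneg (G v)
  have h4 := h.le_pi v
  have : 0 < ‖v‖ ^ 2 := by positivity
  exact le_of_mul_le_mul_right (by linarith) this

lemma apply_loop_le (h : IsLyapunov A P Q R G σ π) {N : V →L[ℝ] U} {Z : V →L[ℝ] V} {c κ : ℝ}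
    (hd : IsDirBound R N Z c κ) (hπ : 0 ≤ π) (v : V) : P (Z v) (Z v) ≤ κ ^ 2 * π * ‖v‖ ^ 2 := by
  calc P (Z v) (Z v) ≤ π * ‖Z v‖ ^ 2 := h.le_pi _
    _ ≤ π * (κ * ‖v‖) ^ 2 := by gcongr; exact hd.loop v
    _ = _ := by ring

/-- Comparison with `P` of the solution of a Lyapunov equation with bounded right side. -/
lemma abs_le_of_rhs (h : IsLyapunov A P Q R G σ π) {X : BilForm V} {w b : ℝ}
    (hw : 0 ≤ w) (hb : 0 ≤ b)
    (hX : ∀ v, |X v v - X (A v) (A v)| ≤ w * ‖v‖ ^ 2 + b * (‖v‖ ^ 2 + ‖A v‖ ^ 2)) (v : V) :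
    |X v v| ≤ (w + 2 * b) / σ * P v v := by
  have hσ := h.pos
  -- Subtracting `b‖·‖²` from the multiple of `P` contributes `+b‖Av‖²` to the decrease of `Y`; this
  -- absorbs the `‖Av‖²` term without any bound on `‖A‖`, at the price of `2b` in place of `b`.
  have key := h.stable.abs_le (X := X) (Y := ((w + 2 * b) / σ) • P - b • innerForm V)
    (fun v => by
      refine (hX v).trans ?_
      simp only [_root_.sub_apply, _root_.smul_apply, smul_eq_mul,
        innerForm_apply_self]
      have h1 := mul_le_mul_of_nonneg_left (h.decrease v)
        (show 0 ≤ (w + 2 * b) / σ by positivity)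
      rw [← mul_assoc, div_mul_cancel₀ _ hσ.ne'] at h1
      linarith) v
  simp only [_root_.sub_apply, _root_.smul_apply, smul_eq_mul,
        innerForm_apply_self] at key
  have : 0 ≤ b * ‖v‖ ^ 2 := by positivity
  linarith

section First

variable {N : V →L[ℝ] U} {Z : V →L[ℝ] V} {c κ : ℝ} {P₁ : BilForm V}

/-- The weight in the AM-GM inequality is `1`, and `R(Gv,Gv) + P(Av,Av) = P(v,v) - Q(v,v)`. Keeping
the term `-Q` instead of dropping it yields the `-1` of `ζ₁`. -/
lemma first_le_amgm [Nontrivial V] (h : IsLyapunov A P Q R G σ π) (hd : IsDirBound R N Z c κ)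
    (hc : 0 ≤ c)
    (h₁ : ∀ v, P₁ v v - P₁ (A v) (A v) = 2 * (R (N v) (G v) + P (Z v) (A v))) (v : V) :
    |P₁ v v| ≤ ((c + κ ^ 2 * π + π) / σ - 1) * P v v := by
  have hσ := h.pos
  have hσπ := h.sigma_le_pi
  have hπ : 0 ≤ π := hσ.le.trans hσπ
  set s := (c + κ ^ 2 * π + π) / σ - 1 with hs
  have hs0 : 0 ≤ s := by
    rw [hs, sub_nonneg, one_le_div hσ]
    have : 0 ≤ κ ^ 2 * π := by positivity
    linarith
  refine h.stable.abs_le (X := P₁) (Y := s • P) (fun v => ?_) v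
  simp only [_root_.smul_apply, smul_eq_mul]
  rw [h₁, ← mul_sub, abs_mul, abs_two, h.eq]
  have e1 := h.psdR.two_mul_abs_le (N v) (G v) one_pos
  have e2 := h.psd.two_mul_abs_le (Z v) (A v) one_pos
  have e3 := hd.feed v
  have e4 := h.apply_loop_le hd hπ v
  have e5 := h.eq v v
  have e6 := h.le_pi v
  have e7 := h.le v
  have e8 := mul_nonneg hs0 (h.psdR.nonneg (G v))
  have e9 := abs_add_le (R (N v) (G v)) (P (Z v) (A v))
  simp only [inv_one, one_mul] at e1 e2
  have e10 : (c + κ ^ 2 * π + π) * ‖v‖ ^ 2 ≤ (s + 1) * Q v v := by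
    have : (c + κ ^ 2 * π + π) = (s + 1) * σ := by rw [hs]; field_simp; ring
    rw [this, mul_assoc]
    exact mul_le_mul_of_nonneg_left e7 (by linarith)
  linarith

lemma first_le_sqrt (h : IsLyapunov A P Q R G σ π) (hd : IsDirBound R N Z c κ)
    (hc : 0 < c) (hπ : 0 < π)
    (h₁ : ∀ v, P₁ v v - P₁ (A v) (A v) = 2 * (R (N v) (G v) + P (Z v) (A v))) (v : V) :
    |P₁ v v| ≤ 2 * √((c + κ ^ 2 * π) * π) / σ * P v v := by
  have hcc : 0 < c + κ ^ 2 * π := by positivity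
  set a := √(c + κ ^ 2 * π) with ha
  set b := √π with hb
  have ha0 : 0 < a := Real.sqrt_pos.2 hcc
  have hb0 : 0 < b := Real.sqrt_pos.2 hπ
  have ha2 : c + κ ^ 2 * π = a ^ 2 := (Real.sq_sqrt hcc.le).symm
  have hb2 : π = b ^ 2 := (Real.sq_sqrt hπ.le).symm
  have hab : √((c + κ ^ 2 * π) * π) = a * b := Real.sqrt_mul hcc.le _
  rw [hab]
  have := h.abs_le_of_rhs (X := P₁) (w := 2 * (a * b)) (b := 0) (by positivity) le_rfl
    (fun v => ?_) v
  · simpa using this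
  rw [h₁, abs_mul, abs_two]
  -- The weight that equalizes the two halves of the AM-GM inequality, whose sizes are `a² = c +
  -- κ²π` and `b² = π`.
  have hs : 0 < b / a := by positivity
  have e1 := h.psdR.two_mul_abs_le (N v) (G v) hs
  have e2 := h.psd.two_mul_abs_le (Z v) (A v) hs
  have e3 := hd.feed v
  have e4 := h.apply_loop_le hd hπ.le v
  have e5 := h.eq v v
  have e6 := h.le_pi v
  have e7 := h.le v
  have e8 : 0 ≤ σ * ‖v‖ ^ 2 := mul_nonneg h.pos.le (by positivity)
  have e9 := abs_add_le (R (N v) (G v)) (P (Z v) (A v))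
  have f1 : b / a * (R (N v) (N v) + P (Z v) (Z v)) ≤ b / a * (a ^ 2 * ‖v‖ ^ 2) := by
    apply mul_le_mul_of_nonneg_left _ hs.le
    rw [← ha2]; linarith
  have f2 : (b / a)⁻¹ * (R (G v) (G v) + P (A v) (A v)) ≤ (b / a)⁻¹ * (b ^ 2 * ‖v‖ ^ 2) := by
    apply mul_le_mul_of_nonneg_left _ (inv_pos.2 hs).le
    rw [← hb2]; linarith
  have g1 : b / a * (a ^ 2 * ‖v‖ ^ 2) = a * b * ‖v‖ ^ 2 := by field_simp
  have g2 : (b / a)⁻¹ * (b ^ 2 * ‖v‖ ^ 2) = a * b * ‖v‖ ^ 2 := by field_simp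
  linarith

lemma abs_apply_le (h : IsLyapunov A P Q R G σ π) (u v : V) :
    |P u v| ≤ π * (‖u‖ * ‖v‖) :=
  BilForm.abs_apply_le h.symm
    (fun v => by rw [abs_of_nonneg (h.psd.nonneg v)]; exact h.le_pi v) u v

/-- The weight `√(σ/c)` makes the `N` term at most `s⁻¹Q`, so the `R` cross term is bounded by
`s⁻¹(Q + R(G·,G·))`, which is exactly the decrease of `s⁻¹P`. The `P` cross term is bounded by
Cauchy-Schwarz and `γ`. -/
lemma first_le_gamma (h : IsLyapunov A P Q R G σ π) (hd : IsDirBound R N Z c κ)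
    (hc : 0 < c) (hπ : 0 ≤ π) (hκ : 0 ≤ κ) {γ : ℝ} (hγ0 : 0 ≤ γ) (hγ : ∀ v, ‖A v‖ ≤ γ * ‖v‖)
    (h₁ : ∀ v, P₁ v v - P₁ (A v) (A v) = 2 * (R (N v) (G v) + P (Z v) (A v))) (v : V) :
    |P₁ v v| ≤ (√(c / σ) + 2 * (κ * π * γ) / σ) * P v v := by
  have hσ := h.pos
  set s := √(σ / c) with hs
  have hs0 : 0 < s := Real.sqrt_pos.2 (by positivity)
  have hs1 : √(c / σ) = s⁻¹ := by rw [hs, ← Real.sqrt_inv, inv_div]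
  have hsc : s * c = s⁻¹ * σ := by
    have : s ^ 2 = σ / c := Real.sq_sqrt (by positivity)
    field_simp
    rw [this]; field_simp
  rw [hs1]
  refine h.stable.abs_le (X := P₁) (Y := (s⁻¹ + 2 * (κ * π * γ) / σ) • P) (fun v => ?_) v
  simp only [_root_.smul_apply, smul_eq_mul]
  rw [h₁, ← mul_sub, abs_mul, abs_two]
  have e1 := h.psdR.two_mul_abs_le (N v) (G v) hs0
  have e2 : |P (Z v) (A v)| ≤ κ * π * γ * ‖v‖ ^ 2 := by
    calc |P (Z v) (A v)| ≤ π * (‖Z v‖ * ‖A v‖) := h.abs_apply_le _ _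
      _ ≤ π * ((κ * ‖v‖) * (γ * ‖v‖)) := by gcongr; exacts [hd.loop v, hγ v]
      _ = _ := by ring
  have e3 := mul_le_mul_of_nonneg_left (hd.feed v) hs0.le
  rw [← mul_assoc, hsc, mul_assoc] at e3
  have e4 := h.eq v v
  have e5 := mul_le_mul_of_nonneg_left (h.decrease v)
    (show 0 ≤ 2 * (κ * π * γ) / σ by positivity)
  rw [← mul_assoc, div_mul_cancel₀ _ hσ.ne'] at e5
  have e6 := mul_le_mul_of_nonneg_left (h.le v) (inv_pos.2 hs0).le
  have e9 := abs_add_le (R (N v) (G v)) (P (Z v) (A v))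
  have e10 : s⁻¹ * (P v v - P (A v) (A v)) = s⁻¹ * Q v v + s⁻¹ * R (G v) (G v) := by
    rw [e4]; ring
  rw [add_mul]
  linarith

end First

section Second

variable {N N' : V →L[ℝ] U} {Z Z' : V →L[ℝ] V} {c κ p γ : ℝ} {P₁ P₁' P₂ : BilForm V}

lemma abs_apply_le_of_le (h : IsLyapunov A P Q R G σ π) {X : BilForm V}
    (hX : ∀ u v, X u v = X v u) (hp : 0 ≤ p) (hXP : ∀ v, |X v v| ≤ p * P v v)
    (u v : V) : |X u v| ≤ p * π * (‖u‖ * ‖v‖) :=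
  BilForm.abs_apply_le hX
    (fun v => (hXP v).trans (by
      rw [mul_assoc]; exact mul_le_mul_of_nonneg_left (h.le_pi v) hp)) u v

lemma second_le (h : IsLyapunov A P Q R G σ π) (hd : IsDirBound R N Z c κ)
    (hd' : IsDirBound R N' Z' c κ) (hc : 0 ≤ c) (hπ : 0 ≤ π) (hκ : 0 ≤ κ) (hp : 0 ≤ p)
    (hγ0 : 0 ≤ γ) (hγ : ∀ v, ‖A v‖ ≤ γ * ‖v‖)
    (hs : ∀ u v, P₁ u v = P₁ v u) (hs' : ∀ u v, P₁' u v = P₁' v u)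
    (h₁ : ∀ v, |P₁ v v| ≤ p * P v v) (h₁' : ∀ v, |P₁' v v| ≤ p * P v v)
    (h₂ : ∀ v, P₂ v v - P₂ (A v) (A v) =
      2 * (R (N v) (N' v) + P (Z v) (Z' v) + P₁ (Z' v) (A v) + P₁' (Z v) (A v))) (v : V) :
    |P₂ v v| ≤ 2 * (c + κ ^ 2 * π + 2 * (κ * γ * p * π)) / σ * P v v := by
  have := h.abs_le_of_rhs (X := P₂) (w := 2 * (c + κ ^ 2 * π + 2 * (κ * γ * p * π))) (b := 0)
    (by positivity) le_rfl (fun v => ?_) v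
  · simpa using this
  rw [h₂, abs_mul, abs_two]
  have e1 := h.psdR.two_mul_abs_le (N v) (N' v) one_pos
  have e2 := h.psd.two_mul_abs_le (Z v) (Z' v) one_pos
  simp only [inv_one, one_mul] at e1 e2
  have e3 := hd.feed v
  have e3' := hd'.feed v
  have e4 := h.apply_loop_le hd hπ v
  have e4' := h.apply_loop_le hd' hπ v
  have e5 : |P₁ (Z' v) (A v)| ≤ κ * γ * p * π * ‖v‖ ^ 2 := by
    calc _ ≤ p * π * (‖Z' v‖ * ‖A v‖) := h.abs_apply_le_of_le hs hp h₁ _ _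
      _ ≤ p * π * ((κ * ‖v‖) * (γ * ‖v‖)) := by gcongr; exacts [hd'.loop v, hγ v]
      _ = _ := by ring
  have e6 : |P₁' (Z v) (A v)| ≤ κ * γ * p * π * ‖v‖ ^ 2 := by
    calc _ ≤ p * π * (‖Z v‖ * ‖A v‖) := h.abs_apply_le_of_le hs' hp h₁' _ _
      _ ≤ p * π * ((κ * ‖v‖) * (γ * ‖v‖)) := by gcongr; exacts [hd.loop v, hγ v]
      _ = _ := by ring
  have e7 := abs_add_le (R (N v) (N' v) + P (Z v) (Z' v) + P₁ (Z' v) (A v)) (P₁' (Z v) (A v))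
  have e8 := abs_add_le (R (N v) (N' v) + P (Z v) (Z' v)) (P₁ (Z' v) (A v))
  have e9 := abs_add_le (R (N v) (N' v)) (P (Z v) (Z' v))
  linarith

/-- Here `‖v‖‖Av‖` is bounded by `(‖v‖² + ‖Av‖²)/2` and absorbed by `abs_le_of_rhs`, so `γ` does not
enter. This is the form needed for `L`; the version with `γ` serves `M`. -/
lemma second_diag_le (h : IsLyapunov A P Q R G σ π) (hd : IsDirBound R N Z c κ)
    (hc : 0 ≤ c) (hπ : 0 ≤ π) (hκ : 0 ≤ κ) (hp : 0 ≤ p)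
    (hs : ∀ u v, P₁ u v = P₁ v u) (h₁ : ∀ v, |P₁ v v| ≤ p * P v v)
    (h₂ : ∀ v, P₂ v v - P₂ (A v) (A v) =
      2 * (R (N v) (N v) + P (Z v) (Z v) + P₁ (Z v) (A v) + P₁ (Z v) (A v))) (v : V) :
    |P₂ v v| ≤ (2 * (c + κ ^ 2 * π) + 4 * (κ * p * π)) / σ * P v v := by
  have := h.abs_le_of_rhs (X := P₂) (w := 2 * (c + κ ^ 2 * π)) (b := 2 * (κ * p * π))
    (by positivity) (by positivity) (fun v => ?_) v
  · convert this using 3; ring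
  rw [h₂, abs_mul, abs_two]
  have e3 := hd.feed v
  have e4 := h.apply_loop_le hd hπ v
  have e5 : |P₁ (Z v) (A v)| ≤ κ * p * π * ((‖v‖ ^ 2 + ‖A v‖ ^ 2) / 2) := by
    calc _ ≤ p * π * (‖Z v‖ * ‖A v‖) := h.abs_apply_le_of_le hs hp h₁ _ _
      _ ≤ p * π * ((κ * ‖v‖) * ‖A v‖) := by gcongr; exact hd.loop v
      _ = κ * p * π * (‖v‖ * ‖A v‖) := by ring
      _ ≤ _ := by gcongr; nlinarith [sq_nonneg (‖v‖ - ‖A v‖)]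
  have e7 := abs_add_le (R (N v) (N v) + P (Z v) (Z v) + P₁ (Z v) (A v)) (P₁ (Z v) (A v))
  have e8 := abs_add_le (R (N v) (N v) + P (Z v) (Z v)) (P₁ (Z v) (A v))
  rw [abs_of_nonneg (add_nonneg (h.psdR.nonneg (N v)) (h.psd.nonneg (Z v)))] at e8
  linarith

lemma third_le {P₂' P₃ : BilForm V} {q : ℝ} (h : IsLyapunov A P Q R G σ π)
    (hd : IsDirBound R N Z c κ) (hd' : IsDirBound R N' Z' c κ)
    (hπ : 0 ≤ π) (hκ : 0 ≤ κ) (hp : 0 ≤ p) (hq : 0 ≤ q)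
    (hs : ∀ u v, P₁ u v = P₁ v u) (hs' : ∀ u v, P₁' u v = P₁' v u)
    (hs₂ : ∀ u v, P₂ u v = P₂ v u) (hs₂' : ∀ u v, P₂' u v = P₂' v u)
    (h₁ : ∀ v, |P₁ v v| ≤ p * P v v) (h₁' : ∀ v, |P₁' v v| ≤ p * P v v)
    (h₂ : ∀ v, |P₂ v v| ≤ q * P v v) (h₂' : ∀ v, |P₂' v v| ≤ q * P v v)
    (h₃ : ∀ v, P₃ v v - P₃ (A v) (A v) =
      2 * (P₂ (Z' v) (A v) + 2 * P₂' (Z v) (A v) + 2 * P₁ (Z v) (Z' v) + P₁' (Z v) (Z v)))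
    (v : V) :
    |P₃ v v| ≤ (6 * (κ * q * π) + 6 * (κ ^ 2 * p * π)) / σ * P v v := by
  have := h.abs_le_of_rhs (X := P₃) (w := 6 * (κ ^ 2 * p * π)) (b := 3 * (κ * q * π))
    (by positivity) (by positivity) (fun v => ?_) v
  · convert this using 3; ring
  rw [h₃, abs_mul, abs_two]
  have e1 : |P₂ (Z' v) (A v)| ≤ κ * q * π * ((‖v‖ ^ 2 + ‖A v‖ ^ 2) / 2) := by
    calc _ ≤ q * π * (‖Z' v‖ * ‖A v‖) := h.abs_apply_le_of_le hs₂ hq h₂ _ _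
      _ ≤ q * π * ((κ * ‖v‖) * ‖A v‖) := by gcongr; exact hd'.loop v
      _ = κ * q * π * (‖v‖ * ‖A v‖) := by ring
      _ ≤ _ := by gcongr; nlinarith [sq_nonneg (‖v‖ - ‖A v‖)]
  have e2 : |P₂' (Z v) (A v)| ≤ κ * q * π * ((‖v‖ ^ 2 + ‖A v‖ ^ 2) / 2) := by
    calc _ ≤ q * π * (‖Z v‖ * ‖A v‖) := h.abs_apply_le_of_le hs₂' hq h₂' _ _
      _ ≤ q * π * ((κ * ‖v‖) * ‖A v‖) := by gcongr; exact hd.loop v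
      _ = κ * q * π * (‖v‖ * ‖A v‖) := by ring
      _ ≤ _ := by gcongr; nlinarith [sq_nonneg (‖v‖ - ‖A v‖)]
  have e3 : |P₁ (Z v) (Z' v)| ≤ κ ^ 2 * p * π * ‖v‖ ^ 2 := by
    calc _ ≤ p * π * (‖Z v‖ * ‖Z' v‖) := h.abs_apply_le_of_le hs hp h₁ _ _
      _ ≤ p * π * ((κ * ‖v‖) * (κ * ‖v‖)) := by gcongr; exacts [hd.loop v, hd'.loop v]
      _ = _ := by ring
  have e4 : |P₁' (Z v) (Z v)| ≤ κ ^ 2 * p * π * ‖v‖ ^ 2 := by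
    calc _ ≤ p * π * (‖Z v‖ * ‖Z v‖) := h.abs_apply_le_of_le hs' hp h₁' _ _
      _ ≤ p * π * ((κ * ‖v‖) * (κ * ‖v‖)) := by gcongr; exacts [hd.loop v, hd.loop v]
      _ = _ := by ring
  have e7 := abs_add_le (P₂ (Z' v) (A v) + 2 * P₂' (Z v) (A v) + 2 * P₁ (Z v) (Z' v))
    (P₁' (Z v) (Z v))
  have e8 := abs_add_le (P₂ (Z' v) (A v) + 2 * P₂' (Z v) (A v)) (2 * P₁ (Z v) (Z' v))
  have e9 := abs_add_le (P₂ (Z' v) (A v)) (2 * P₂' (Z v) (A v))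
  rw [abs_mul, abs_two] at e8 e9
  linarith

end Second

end IsLyapunov

end Lyapunov

/-! ### Differentiation of Lyapunov equations in a parameter -/

section Calculus

variable {E F : Type*} [NormedAddCommGroup E] [NormedSpace ℝ E]
  [NormedAddCommGroup F] [NormedSpace ℝ F]

/-- The derivative of `g` in the fixed direction `z`, as a function of the point. -/
noncomputable def dirDeriv (z : E) (g : E → F) (k : E) : F := fderiv ℝ g k z

lemma ContDiffOn.dirDeriv {g : E → F} {Ω : Set E} (hg : ContDiffOn ℝ ∞ g Ω) (hΩ : IsOpen Ω)
    (z : E) : ContDiffOn ℝ ∞ (dirDeriv z g) Ω :=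
  (hg.fderiv_of_isOpen hΩ (m := ∞) (by simp)).clm_apply contDiffOn_const

lemma ContDiffOn.hasDerivAt_line {g : E → F} {Ω : Set E} (hg : ContDiffOn ℝ ∞ g Ω)
    (hΩ : IsOpen Ω) {k e : E} {t : ℝ} (hk : k + t • e ∈ Ω) :
    HasDerivAt (fun s : ℝ => g (k + s • e)) (_root_.dirDeriv e g (k + t • e)) t := by
  have h1 : DifferentiableAt ℝ g (k + t • e) :=
    (hg.contDiffAt (hΩ.mem_nhds hk)).differentiableAt (by simp)
  have h2 : HasDerivAt (fun s : ℝ => k + s • e) e t := by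
    simpa using ((hasDerivAt_id t).smul_const e).const_add k
  exact h1.hasFDerivAt.comp_hasDerivAt t h2

lemma ContDiffOn.hasDerivAt_line_zero {g : E → F} {Ω : Set E} (hg : ContDiffOn ℝ ∞ g Ω)
    (hΩ : IsOpen Ω) {k : E} (hk : k ∈ Ω) (e : E) :
    HasDerivAt (fun s : ℝ => g (k + s • e)) (_root_.dirDeriv e g k) 0 := by
  have := hg.hasDerivAt_line hΩ (k := k) (e := e) (t := 0) (by simpa using hk)
  simpa using this

lemma IsOpen.eventually_line_mem {Ω : Set E} (hΩ : IsOpen Ω) {k : E} (hk : k ∈ Ω) (e : E) :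
    ∀ᶠ s : ℝ in 𝓝 0, k + s • e ∈ Ω := by
  have : ContinuousAt (fun s : ℝ => k + s • e) 0 := by fun_prop
  exact this.preimage_mem_nhds (by simpa using hΩ.mem_nhds hk)

lemma dirDeriv_congr {g h : E → F} {Ω : Set E} (hΩ : IsOpen Ω) (hgh : Set.EqOn g h Ω) (z : E) :
    Set.EqOn (dirDeriv z g) (dirDeriv z h) Ω := fun k hk => by
  rw [dirDeriv, dirDeriv, (hgh.eventuallyEq_of_mem (hΩ.mem_nhds hk)).fderiv_eq]

lemma dirDeriv_clm_comp {F' : Type*} [NormedAddCommGroup F'] [NormedSpace ℝ F'] {g : E → F}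
    {Ω : Set E} (hg : ContDiffOn ℝ ∞ g Ω) (hΩ : IsOpen Ω) (φ : F →L[ℝ] F') (z : E) :
    Set.EqOn (dirDeriv z fun k => φ (g k)) (fun k => φ (dirDeriv z g k)) Ω := fun k hk => by
  have h1 : DifferentiableAt ℝ g k :=
    (hg.contDiffAt (hΩ.mem_nhds hk)).differentiableAt (by simp)
  have := (φ.hasFDerivAt.comp k h1.hasFDerivAt).fderiv
  rw [Function.comp_def] at this
  simp [dirDeriv, this]

variable {V U : Type*} [NormedAddCommGroup V] [NormedSpace ℝ V]
  [NormedAddCommGroup U] [NormedSpace ℝ U]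

lemma HasDerivAt.bilForm_apply {X : ℝ → BilForm V} {X' : BilForm V} {a b : ℝ → V} {a' b' : V}
    {t : ℝ} (hX : HasDerivAt X X' t) (ha : HasDerivAt a a' t) (hb : HasDerivAt b b' t) :
    HasDerivAt (fun s => X s (a s) (b s))
      (X' (a t) (b t) + X t a' (b t) + X t (a t) b') t := by
  simpa using (hX.clm_apply ha).clm_apply hb

/-- The closed loop map `A - B N(k)` of the feedback `N(k)`. -/
noncomputable def loopMap (A : V →L[ℝ] V) (B : U →L[ℝ] V) (N : E →L[ℝ] V →L[ℝ] U)
    (k : E) : V →L[ℝ] V :=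
  A - B ∘L N k

/-- The derivative of `loopMap` in the direction `z`. -/
noncomputable def loopDir (B : U →L[ℝ] V) (N : E →L[ℝ] V →L[ℝ] U) (z : E) : V →L[ℝ] V := -(B ∘L N z)

variable {A : V →L[ℝ] V} {B : U →L[ℝ] V} {N : E →L[ℝ] V →L[ℝ] U} {Q : BilForm V} {R : BilForm U}
  {Ω : Set E}

lemma loopMap_add_smul (k e : E) (s : ℝ) (v : V) :
    loopMap A B N (k + s • e) v = loopMap A B N k v + s • loopDir B N e v := by
  simp [loopMap, loopDir]; abel

lemma hasDerivAt_loopMap (k e : E) (v : V) :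
    HasDerivAt (fun s : ℝ => loopMap A B N (k + s • e) v) (loopDir B N e v) 0 := by
  simp only [loopMap_add_smul]
  simpa using ((hasDerivAt_id (0 : ℝ)).smul_const (loopDir B N e v)).const_add
    (loopMap A B N k v)

lemma hasDerivAt_feedback (k e : E) (v : V) :
    HasDerivAt (fun s : ℝ => N (k + s • e) v) (N e v) 0 := by
  simp only [map_add, map_smul, _root_.add_apply, _root_.smul_apply]
  simpa using ((hasDerivAt_id (0 : ℝ)).smul_const (N e v)).const_add (N k v)

/-- Differentiation of a Lyapunov equation which holds on an open set of parameters. -/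
lemma dirDeriv_lyapunov {X : E → BilForm V} (hX : ContDiffOn ℝ ∞ X Ω) (hΩ : IsOpen Ω) {u v : V}
    {g : E → ℝ} (h : ∀ k ∈ Ω, X k u v - X k (loopMap A B N k u) (loopMap A B N k v) = g k)
    {k : E} (hk : k ∈ Ω) (e : E) {g' : ℝ}
    (hg : HasDerivAt (fun s : ℝ => g (k + s • e)) g' 0) :
    dirDeriv e X k u v - dirDeriv e X k (loopMap A B N k u) (loopMap A B N k v) =
      g' + X k (loopDir B N e u) (loopMap A B N k v)
        + X k (loopMap A B N k u) (loopDir B N e v) := by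
  have h0 := hX.hasDerivAt_line_zero hΩ hk e
  have h1 := h0.bilForm_apply (hasDerivAt_const 0 u) (hasDerivAt_const 0 v)
  have h2 := h0.bilForm_apply (hasDerivAt_loopMap (A := A) (B := B) (N := N) k e u)
    (hasDerivAt_loopMap (A := A) (B := B) (N := N) k e v)
  have h3 := (h1.sub h2).congr_of_eventuallyEq (f₁ := fun s : ℝ => g (k + s • e))
    ((hΩ.eventually_line_mem hk e).mono fun s hs => (h _ hs).symm)
  have h4 := h3.unique hg
  simp only [zero_smul, add_zero, map_zero, _root_.zero_apply] at h4
  linarith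

lemma dirDeriv_symm {X : E → BilForm V} (hX : ContDiffOn ℝ ∞ X Ω) (hΩ : IsOpen Ω)
    (h : ∀ k ∈ Ω, ∀ u v, X k u v = X k v u) (e : E) :
    ∀ k ∈ Ω, ∀ u v, dirDeriv e X k u v = dirDeriv e X k v u := by
  intro k hk u v
  have h0 := hX.hasDerivAt_line_zero hΩ hk e
  have h1 := h0.bilForm_apply (hasDerivAt_const 0 u) (hasDerivAt_const 0 v)
  have h2 := h0.bilForm_apply (hasDerivAt_const 0 v) (hasDerivAt_const 0 u)
  have h3 := h1.congr_of_eventuallyEq (f₁ := fun s : ℝ => X (k + s • e) v u)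
    ((hΩ.eventually_line_mem hk e).mono fun s hs => (h _ hs v u))
  have h4 := h3.unique h2
  simpa using h4

/-- `P k` solves the Lyapunov equation of the closed loop, smoothly in `k ∈ Ω`. -/
structure IsLyapunovFamily (A : V →L[ℝ] V) (B : U →L[ℝ] V) (N : E →L[ℝ] V →L[ℝ] U)
    (Q : BilForm V) (R : BilForm U) (Ω : Set E) (P : E → BilForm V) : Prop where
  isOpen : IsOpen Ω
  smooth : ContDiffOn ℝ ∞ P Ω
  symmR : ∀ u v, R u v = R v u
  symm : ∀ k ∈ Ω, ∀ u v, P k u v = P k v u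
  eq : ∀ k ∈ Ω, ∀ u v, P k u v - P k (loopMap A B N k u) (loopMap A B N k v) =
    Q u v + R (N k u) (N k v)

namespace IsLyapunovFamily

variable {P : E → BilForm V}

lemma first_symm (h : IsLyapunovFamily A B N Q R Ω P) (z : E) :
    ∀ k ∈ Ω, ∀ u v, dirDeriv z P k u v = dirDeriv z P k v u :=
  dirDeriv_symm h.smooth h.isOpen h.symm z

lemma second_symm (h : IsLyapunovFamily A B N Q R Ω P) (z e : E) :
    ∀ k ∈ Ω, ∀ u v, dirDeriv e (dirDeriv z P) k u v = dirDeriv e (dirDeriv z P) k v u :=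
  dirDeriv_symm (h.smooth.dirDeriv h.isOpen z) h.isOpen (h.first_symm z) e

lemma first_eq (h : IsLyapunovFamily A B N Q R Ω P) (z : E) : ∀ k ∈ Ω, ∀ u v,
    dirDeriv z P k u v - dirDeriv z P k (loopMap A B N k u) (loopMap A B N k v) =
      R (N z u) (N k v) + R (N k u) (N z v) + P k (loopDir B N z u) (loopMap A B N k v)
        + P k (loopMap A B N k u) (loopDir B N z v) := by
  intro k hk u v
  refine dirDeriv_lyapunov h.smooth h.isOpen (fun k hk => h.eq k hk u v) hk z ?_
  have := (((hasDerivAt_const (0 : ℝ) R).bilForm_apply (hasDerivAt_feedback (N := N) k z u)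
    (hasDerivAt_feedback (N := N) k z v)).const_add (Q u v))
  simpa using this

lemma second_eq (h : IsLyapunovFamily A B N Q R Ω P) (z e : E) : ∀ k ∈ Ω, ∀ u v,
    dirDeriv e (dirDeriv z P) k u v
        - dirDeriv e (dirDeriv z P) k (loopMap A B N k u) (loopMap A B N k v) =
      R (N z u) (N e v) + R (N e u) (N z v)
        + P k (loopDir B N z u) (loopDir B N e v) + P k (loopDir B N e u) (loopDir B N z v)
        + dirDeriv e P k (loopDir B N z u) (loopMap A B N k v)
        + dirDeriv e P k (loopMap A B N k u) (loopDir B N z v)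
        + dirDeriv z P k (loopDir B N e u) (loopMap A B N k v)
        + dirDeriv z P k (loopMap A B N k u) (loopDir B N e v) := by
  intro k hk u v
  have hP := h.smooth.hasDerivAt_line_zero h.isOpen hk e
  have h1 := (hasDerivAt_const (0 : ℝ) R).bilForm_apply (hasDerivAt_const 0 (N z u))
    (hasDerivAt_feedback (N := N) k e v)
  have h2 := (hasDerivAt_const (0 : ℝ) R).bilForm_apply (hasDerivAt_feedback (N := N) k e u)
    (hasDerivAt_const 0 (N z v))
  have h3 := hP.bilForm_apply (hasDerivAt_const 0 (loopDir B N z u))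
    (hasDerivAt_loopMap (A := A) (B := B) (N := N) k e v)
  have h4 := hP.bilForm_apply (hasDerivAt_loopMap (A := A) (B := B) (N := N) k e u)
    (hasDerivAt_const 0 (loopDir B N z v))
  have := dirDeriv_lyapunov (h.smooth.dirDeriv h.isOpen z) h.isOpen
    (fun k hk => h.first_eq z k hk u v) hk e (((h1.add h2).add h3).add h4)
  simp only [zero_smul, add_zero, map_zero, _root_.zero_apply, zero_add] at this
  rw [this]
  ring

/-- The quadratic form suffices here, since the second moment sees only the diagonal. The directions
`z, z, e` are those along which the Hessian's quadratic form in `z` varies. -/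
lemma third_eq (h : IsLyapunovFamily A B N Q R Ω P) (z e : E) : ∀ k ∈ Ω, ∀ v,
    dirDeriv e (dirDeriv z (dirDeriv z P)) k v v
        - dirDeriv e (dirDeriv z (dirDeriv z P)) k (loopMap A B N k v) (loopMap A B N k v) =
      2 * (dirDeriv z (dirDeriv z P) k (loopDir B N e v) (loopMap A B N k v)
        + 2 * dirDeriv e (dirDeriv z P) k (loopDir B N z v) (loopMap A B N k v)
        + 2 * dirDeriv z P k (loopDir B N z v) (loopDir B N e v)
        + dirDeriv e P k (loopDir B N z v) (loopDir B N z v)) := by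
  intro k hk v
  have hP := h.smooth.hasDerivAt_line_zero h.isOpen hk e
  have hP1 := (h.smooth.dirDeriv h.isOpen z).hasDerivAt_line_zero h.isOpen hk e
  have h1 := hP.bilForm_apply (hasDerivAt_const 0 (loopDir B N z v))
    (hasDerivAt_const 0 (loopDir B N z v))
  have h2 := hP1.bilForm_apply (hasDerivAt_const 0 (loopDir B N z v))
    (hasDerivAt_loopMap (A := A) (B := B) (N := N) k e v)
  have := dirDeriv_lyapunov ((h.smooth.dirDeriv h.isOpen z).dirDeriv h.isOpen z) h.isOpen
    (u := v) (v := v) (g := fun k => 2 * R (N z v) (N z v)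
        + 2 * P k (loopDir B N z v) (loopDir B N z v)
        + 4 * dirDeriv z P k (loopDir B N z v) (loopMap A B N k v))
    (fun k hk => by
      rw [h.second_eq z z k hk v v,
        h.first_symm z k hk (loopMap A B N k v) (loopDir B N z v)]; ring) hk e
    (((h1.const_mul 2).const_add (2 * R (N z v) (N z v))).add (h2.const_mul 4))
  simp only [zero_smul, add_zero, map_zero, _root_.zero_apply] at this
  rw [this, h.second_symm z z k hk (loopMap A B N k v) (loopDir B N e v)]
  ring

end IsLyapunovFamily

/-! ### Existence and smoothness of the value forms -/

section Existence

set_option maxSynthPendingDepth 5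

variable [FiniteDimensional ℝ V]

/-- The Lyapunov operator `X ↦ X - X(M·, M·)`. -/
noncomputable def lyapOp (M : V →L[ℝ] V) : BilForm V →L[ℝ] BilForm V :=
  LinearMap.toContinuousLinearMap
    { toFun := fun X : BilForm V => X - X.bilinearComp M M
      map_add' := fun X Y => by ext; simp; ring
      map_smul' := fun c X => by ext; simp; ring }

lemma lyapOp_apply (M : V →L[ℝ] V) (X : BilForm V) (u v : V) :
    lyapOp M X u v = X u v - X (M u) (M v) := by
  simp [lyapOp]

/-- Injectivity is `PowStable.eq_zero`, and the space of forms is finite-dimensional. -/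
lemma isUnit_lyapOp {M : V →L[ℝ] V} (hM : PowStable M) : IsUnit (lyapOp M) := by
  have hinj : LinearMap.ker (lyapOp M : BilForm V →ₗ[ℝ] BilForm V) = ⊥ := by
    refine LinearMap.ker_eq_bot'.2 fun X hX => hM.eq_zero fun u v => ?_
    have h1 : lyapOp M X u v = 0 := by
      rw [show lyapOp M X = 0 from hX]; simp
    rw [lyapOp_apply] at h1
    linarith
  have := (LinearMap.isUnit_iff_ker_eq_bot _).2 hinj
  exact ContinuousLinearMap.isUnit_iff_bijective.2 ((Module.End.isUnit_iff _).1 this)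

lemma exists_isLyapunovFamily [FiniteDimensional ℝ E] (hΩ : IsOpen Ω)
    (hstab : ∀ k ∈ Ω, PowStable (loopMap A B N k))
    (hQ : ∀ u v, Q u v = Q v u) (hR : ∀ u v, R u v = R v u) :
    ∃ P : E → BilForm V, IsLyapunovFamily A B N Q R Ω P := by
  let W : E → BilForm V := fun k => Q + R.bilinearComp (N k) (N k)
  have hW : ∀ k u v, W k u v = Q u v + R (N k u) (N k v) := fun k u v => by simp [W]
  -- `Ring.inverse` is total, zero off the units, and smooth at every unit; so smoothness on `Ω`
  -- needs no choice of inverses.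
  let P : E → BilForm V := fun k => Ring.inverse (lyapOp (loopMap A B N k)) (W k)
  have heq : ∀ k ∈ Ω, ∀ u v, P k u v - P k (loopMap A B N k u) (loopMap A B N k v) =
      Q u v + R (N k u) (N k v) := by
    intro k hk u v
    rw [← lyapOp_apply, ← hW]
    have := Ring.mul_inverse_cancel _ (isUnit_lyapOp (hstab k hk))
    have h2 := congrArg (fun T : BilForm V →L[ℝ] BilForm V => T (W k)) this
    change lyapOp (loopMap A B N k) (P k) = W k at h2
    rw [h2]
  refine ⟨P, hΩ, ?_, hR, ?_, heq⟩
  · have h1 : ContDiff ℝ ∞ fun k => lyapOp (loopMap A B N k) := by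
      refine contDiff_clm_apply_iff.2 fun X => contDiff_clm_apply_iff.2 fun u =>
        contDiff_clm_apply_iff.2 fun v => ?_
      simp only [lyapOp_apply, loopMap]
      fun_prop
    have h2 : ContDiff ℝ ∞ W := by
      refine contDiff_clm_apply_iff.2 fun u => contDiff_clm_apply_iff.2 fun v => ?_
      simp only [hW]
      fun_prop
    intro k hk
    obtain ⟨T, hT⟩ := isUnit_lyapOp (hstab k hk)
    have h3 := contDiffAt_ringInverse ℝ (n := ∞) T
    rw [hT] at h3
    exact ((h3.comp k h1.contDiffAt).clm_apply h2.contDiffAt).contDiffWithinAt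
  · intro k hk u v
    -- The right side is symmetric, so the antisymmetric part solves the homogeneous equation and
    -- vanishes.
    have := (hstab k hk).eq_zero (X := P k - (P k).flip) (fun u v => by
      have e1 := heq k hk u v
      have e2 := heq k hk v u
      rw [hQ v u, hR (N k v) (N k u)] at e2
      simp only [_root_.sub_apply, ContinuousLinearMap.flip_apply]
      linarith)
    have h2 : (P k - (P k).flip) u v = 0 := by rw [this]; simp
    simp only [_root_.sub_apply, ContinuousLinearMap.flip_apply] at h2
    linarith

end Existence

end Calculus

/-! ### Gradient descent near a nondegenerate minimum -/

section GradientDescent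

lemma sub_le_sub_of_hasDerivAt_le {g q g' q' : ℝ → ℝ}
    (hg : ∀ t ∈ Set.Icc (0 : ℝ) 1, HasDerivAt g (g' t) t) (hq : ∀ t, HasDerivAt q (q' t) t)
    (h : ∀ t ∈ Set.Icc (0 : ℝ) 1, g' t ≤ q' t) : g 1 - g 0 ≤ q 1 - q 0 := by
  have hd : ∀ t ∈ Set.Icc (0 : ℝ) 1, HasDerivAt (fun t => g t - q t) (g' t - q' t) t :=
    fun t ht => (hg t ht).sub (hq t)
  have := antitoneOn_of_deriv_nonpos (convex_Icc (0 : ℝ) 1) (f := fun t => g t - q t)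
    (fun t ht => (hd t ht).continuousAt.continuousWithinAt)
    (fun t ht => (hd t (interior_subset ht)).differentiableAt.differentiableWithinAt)
    (fun t ht => by
      rw [(hd t (interior_subset ht)).deriv]
      exact sub_nonpos.2 (h t (interior_subset ht)))
    (by simp : (0 : ℝ) ∈ Set.Icc (0 : ℝ) 1) (by simp : (1 : ℝ) ∈ Set.Icc (0 : ℝ) 1) zero_le_one
  simp only at this
  linarith

lemma ContDiffOn.fderiv_fderiv_apply {F : Type*} [NormedAddCommGroup F] [NormedSpace ℝ F]
    {f : F → ℝ} {Ω : Set F} (hf : ContDiffOn ℝ ∞ f Ω) (hΩ : IsOpen Ω) {x : F} (hx : x ∈ Ω)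
    (a b : F) : fderiv ℝ (fderiv ℝ f) x a b = _root_.dirDeriv a (_root_.dirDeriv b f) x := by
  have hd : DifferentiableAt ℝ (fderiv ℝ f) x :=
    ((hf.fderiv_of_isOpen hΩ (m := ∞) (by simp)).contDiffAt
      (hΩ.mem_nhds hx)).differentiableAt (by simp)
  have := (hd.hasFDerivAt.clm_apply (hasFDerivAt_const b x)).fderiv
  change _ = fderiv ℝ (fun k => fderiv ℝ f k b) x a
  rw [this]
  simp

lemma ContDiffOn.dirDeriv_comm {F : Type*} [NormedAddCommGroup F] [NormedSpace ℝ F]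
    {f : F → ℝ} {Ω : Set F} (hf : ContDiffOn ℝ ∞ f Ω) (hΩ : IsOpen Ω) {x : F} (hx : x ∈ Ω)
    (a b : F) :
    _root_.dirDeriv a (_root_.dirDeriv b f) x = _root_.dirDeriv b (_root_.dirDeriv a f) x := by
  rw [← hf.fderiv_fderiv_apply hΩ hx, ← hf.fderiv_fderiv_apply hΩ hx]
  exact ((hf.contDiffAt (hΩ.mem_nhds hx)).isSymmSndFDerivAt
    (by simpa using WithTop.coe_le_coe.2 (le_top : (2 : ℕ∞) ≤ ⊤))).eq a b

variable {H : Type*} [NormedAddCommGroup H] [InnerProductSpace ℝ H]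

/-- Second and third derivative bounds for `f` on the closed ball about a critical point `x₀`. -/
structure IsDescentRegion (f : H → ℝ) (Ω : Set H) (x₀ : H) (r₀ l L M : ℝ) : Prop where
  isOpen : IsOpen Ω
  smooth : ContDiffOn ℝ ∞ f Ω
  subset : Metric.closedBall x₀ r₀ ⊆ Ω
  crit : ∀ z, dirDeriv z f x₀ = 0
  hess_ge : ∀ z, l * ‖z‖ ^ 2 ≤ dirDeriv z (dirDeriv z f) x₀
  hess_le : ∀ x ∈ Metric.closedBall x₀ r₀, ∀ z, dirDeriv z (dirDeriv z f) x ≤ L * ‖z‖ ^ 2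
  third_le : ∀ x ∈ Metric.closedBall x₀ r₀, ∀ z e,
    |dirDeriv e (dirDeriv z (dirDeriv z f)) x| ≤ M * ‖z‖ ^ 2 * ‖e‖

namespace IsDescentRegion

variable {f : H → ℝ} {Ω : Set H} {x₀ : H} {r₀ l L M : ℝ}

lemma line_mem {x : H} (hx : x ∈ Metric.closedBall x₀ r₀) {t : ℝ} (ht : t ∈ Set.Icc (0 : ℝ) 1) :
    x₀ + t • (x - x₀) ∈ Metric.closedBall x₀ r₀ := by
  have h0 : 0 ≤ r₀ := dist_nonneg.trans hx
  exact (convex_closedBall x₀ r₀).add_smul_sub_mem (Metric.mem_closedBall_self h0) hx ht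

lemma hess_ge_of_mem (h : IsDescentRegion f Ω x₀ r₀ l L M) {x : H}
    (hx : x ∈ Metric.closedBall x₀ r₀) (z : H) :
    (l - M * ‖x - x₀‖) * ‖z‖ ^ 2 ≤ dirDeriv z (dirDeriv z f) x := by
  have hs := (h.smooth.dirDeriv h.isOpen z).dirDeriv h.isOpen z
  have key := sub_le_sub_of_hasDerivAt_le
    (g := fun t : ℝ => -dirDeriv z (dirDeriv z f) (x₀ + t • (x - x₀)))
    (q := fun t => M * ‖z‖ ^ 2 * ‖x - x₀‖ * t)
    (q' := fun _ => M * ‖z‖ ^ 2 * ‖x - x₀‖)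
    (fun t ht => (hs.hasDerivAt_line h.isOpen (h.subset (line_mem hx ht))).neg)
    (fun t => by simpa using (hasDerivAt_id t).const_mul (M * ‖z‖ ^ 2 * ‖x - x₀‖))
    (fun t ht => (neg_le_abs _).trans (h.third_le _ (line_mem hx ht) z (x - x₀)))
  simp only [one_smul, add_sub_cancel, zero_smul, add_zero, mul_one, mul_zero, sub_zero] at key
  have := h.hess_ge z
  linarith

/-- The displacement `y - x₀` is the integral over the segment of `(I - ηH)(x - x₀)`, with `H` the
Hessian of `f`. The condition `ηL ≤ 1` makes `I - ηH` nonnegative, so its size at parameter `t` is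
at most `1 - ηl + ηM‖x - x₀‖t`; integrating `t` gives the factor `1/2`. -/
lemma norm_step_le (h : IsDescentRegion f Ω x₀ r₀ l L M) {η : ℝ} (hη : 0 < η)
    (hηL : η * L ≤ 1) (hM : 0 ≤ M) {x y : H} (hx : x ∈ Metric.closedBall x₀ r₀)
    (hy : ∀ w, inner ℝ w y = inner ℝ w x - η * dirDeriv w f x) :
    ‖y - x₀‖ ≤ (1 - η * l + η * M * ‖x - x₀‖ / 2) * ‖x - x₀‖ := by
  set Δ := x - x₀ with hΔ
  -- The integral is tested against the new error itself, which reduces the vector estimate to a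
  -- scalar one; dividing by `‖w‖` finishes.
  set w := y - x₀ with hw
  have hfd : ∀ t ∈ Set.Icc (0 : ℝ) 1, HasDerivAt
      (fun t : ℝ => inner ℝ w (x₀ + t • Δ) - η * dirDeriv w f (x₀ + t • Δ))
      (inner ℝ w Δ - η * dirDeriv Δ (dirDeriv w f) (x₀ + t • Δ)) t := by
    intro t ht
    have h1 := (h.smooth.dirDeriv h.isOpen w).hasDerivAt_line h.isOpen
      (h.subset (line_mem hx ht))
    have h2 : HasDerivAt (fun t : ℝ => (inner ℝ w (x₀ + t • Δ) : ℝ)) (inner ℝ w Δ) t := by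
      simp only [inner_add_right, inner_smul_right]
      simpa using ((hasDerivAt_id t).mul_const (inner ℝ w Δ : ℝ)).const_add (inner ℝ w x₀ : ℝ)
    exact h2.sub (h1.const_mul η)
  have hq : ∀ t : ℝ, HasDerivAt
      (fun t => ((1 - η * l) * t + η * M * ‖Δ‖ * (t ^ 2 / 2)) * (‖Δ‖ * ‖w‖))
      ((1 - η * l + η * M * ‖Δ‖ * t) * (‖Δ‖ * ‖w‖)) t := by
    intro t
    have h1 := ((hasDerivAt_id t).const_mul (1 - η * l)).add
      ((((hasDerivAt_id t).pow 2).div_const 2).const_mul (η * M * ‖Δ‖))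
    refine (h1.mul_const (‖Δ‖ * ‖w‖)).congr_deriv ?_
    simp
  have key := sub_le_sub_of_hasDerivAt_le hfd hq (fun t ht => by
    have hmem : x₀ + t • Δ ∈ Metric.closedBall x₀ r₀ := line_mem hx ht
    have hmem' := h.subset hmem
    have hnorm : ‖x₀ + t • Δ - x₀‖ = t * ‖Δ‖ := by
      rw [add_sub_cancel_left, norm_smul, Real.norm_of_nonneg ht.1]
    set T : BilForm H := innerForm H - η • fderiv ℝ (fderiv ℝ f) (x₀ + t • Δ) with hT
    have hTapp : ∀ a b, T a b = inner ℝ a b - η * dirDeriv a (dirDeriv b f) (x₀ + t • Δ) := by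
      intro a b
      rw [← h.smooth.fderiv_fderiv_apply h.isOpen hmem' a b]
      simp [hT, innerForm_apply]
    have hsymm : ∀ a b, T a b = T b a := by
      intro a b
      rw [hTapp, hTapp, real_inner_comm, h.smooth.dirDeriv_comm h.isOpen hmem' a b]
    have hbd : ∀ a, |T a a| ≤ (1 - η * l + η * M * ‖Δ‖ * t) * ‖a‖ ^ 2 := by
      intro a
      have e1 := h.hess_le _ hmem a
      have e2 := h.hess_ge_of_mem hmem a
      rw [hnorm] at e2
      have e3 := mul_le_mul_of_nonneg_left e1 hη.le
      have e4 := mul_le_mul_of_nonneg_left e2 hη.le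
      have e5 := mul_le_mul_of_nonneg_right hηL (sq_nonneg ‖a‖)
      rw [hTapp, real_inner_self_eq_norm_sq, abs_le]
      constructor
      · nlinarith [abs_nonneg (T a a)]
      · nlinarith
    have := (le_abs_self _).trans (BilForm.abs_apply_le hsymm hbd Δ w)
    rw [hTapp, real_inner_comm] at this
    exact this)
  simp only [one_smul, zero_smul, add_zero, h.crit, mul_zero, sub_zero, mul_one] at key
  have hxx : x₀ + Δ = x := by rw [hΔ]; abel
  rw [hxx, ← hy, ← inner_sub_right, ← hw, real_inner_self_eq_norm_sq] at key
  -- If the new error vanishes, the right side must still be nonnegative; this follows from `ηl ≤ ηL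
  -- ≤ 1`, comparing the Hessian bounds at `x₀`.
  rcases eq_or_ne ‖w‖ 0 with h0 | h0
  · rw [h0]
    rcases eq_or_ne ‖Δ‖ 0 with h1 | h1
    · simp [h1]
    · have h2 : 0 < ‖Δ‖ ^ 2 := by positivity
      have h3 := (h.hess_ge Δ).trans (h.hess_le x₀ (Metric.mem_closedBall_self
        (dist_nonneg.trans hx)) Δ)
      have h4 := mul_le_mul_of_nonneg_left (le_of_mul_le_mul_right h3 h2) hη.le
      have : 0 ≤ η * M * ‖Δ‖ / 2 := by positivity
      exact mul_nonneg (by linarith) (norm_nonneg _)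
  · have hpos : 0 < ‖w‖ := lt_of_le_of_ne (norm_nonneg _) (Ne.symm h0)
    refine le_of_mul_le_mul_right ?_ hpos
    nlinarith

/-- With `u = t(1-a)` the hypothesis reads `b ≤ (1-u)a`, and `(1-u)(1+u) ≤ 1` gives `b(1+u) ≤ a`,
which is the last claim after clearing denominators. -/
lemma div_one_sub_contract {a b t : ℝ} (ha : 0 < a) (ha1 : a < 1) (ht : 0 < t)
    (hab : b ≤ (1 - t + t * a) * a) :
    b < 1 ∧ b ≤ a ∧ b / (1 - b) ≤ a / (1 - a) * (1 / (1 + t)) := by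
  have hba : b ≤ a := by
    nlinarith [mul_pos ht (sub_pos.2 ha1), mul_pos (mul_pos ht (sub_pos.2 ha1)) ha]
  have hb1 : b < 1 := hba.trans_lt ha1
  refine ⟨hb1, hba, ?_⟩
  rw [div_mul_div_comm, div_le_div_iff₀ (sub_pos.2 hb1) (by nlinarith)]
  have h1 : 0 < t * (1 - a) := mul_pos ht (sub_pos.2 ha1)
  have h2 : b * (1 + t * (1 - a)) ≤ a := by
    calc b * (1 + t * (1 - a)) ≤ (1 - t + t * a) * a * (1 + t * (1 - a)) := by gcongr
      _ = a - a * (t * (1 - a)) ^ 2 := by ring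
      _ ≤ a := by nlinarith [mul_nonneg ha.le (sq_nonneg (t * (1 - a)))]
  nlinarith

/-- Local linear convergence of gradient descent with step `η ≤ 1 / L`. -/
theorem iterate_bound (h : IsDescentRegion f Ω x₀ r₀ l L M) {η : ℝ} (hη : 0 < η)
    (hηL : η * L ≤ 1) (hl : 0 < l) (hM : 0 < M) {x : ℕ → H}
    (hx : ∀ i w, inner ℝ w (x (i + 1)) = inner ℝ w (x i) - η * dirDeriv w f (x i))
    (hr₀ : ‖x 0 - x₀‖ = r₀) (hr : r₀ < 2 * l / M) (i : ℕ) :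
    x i ∈ Metric.closedBall x₀ r₀ ∧
      ‖x i - x₀‖ ≤ 2 * l / M * r₀ / (2 * l / M - r₀) * (1 / (1 + η * l)) ^ i := by
  have h0 : 0 ≤ r₀ := hr₀ ▸ norm_nonneg _
  set ρ := 2 * l / M with hρ
  have hρ0 : 0 < ρ := by positivity
  have hρM : M * ρ = 2 * l := by rw [hρ]; field_simp
  -- The quantity that contracts by exactly the stated factor is `a/(1-a)` for the normalized error
  -- `a = ‖x i - x₀‖/ρ`; the error itself contracts more slowly at first.
  have main : ∀ i, x i ∈ Metric.closedBall x₀ r₀ ∧ ‖x i - x₀‖ / ρ < 1 ∧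
      ‖x i - x₀‖ / ρ / (1 - ‖x i - x₀‖ / ρ) ≤
        r₀ / ρ / (1 - r₀ / ρ) * (1 / (1 + η * l)) ^ i := by
    intro i
    induction i with
    | zero => exact ⟨by simp [dist_eq_norm, hr₀], by rwa [hr₀, div_lt_one hρ0], by simp [hr₀]⟩
    | succ i ih =>
      obtain ⟨hmem, hlt, hle⟩ := ih
      have hstep := h.norm_step_le hη hηL hM.le hmem (hx i)
      -- The contraction lemma needs a positive error; a zero error stays zero by the step estimate.
      rcases (norm_nonneg (x i - x₀)).eq_or_lt with hz | hpos
      · rw [← hz, mul_zero] at hstep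
        have hz' : ‖x (i + 1) - x₀‖ = 0 := le_antisymm hstep (norm_nonneg _)
        refine ⟨by simp [dist_eq_norm, hz', h0], by simp [hz'], ?_⟩
        rw [hz']
        have : 0 ≤ 1 - r₀ / ρ := by rw [sub_nonneg, div_le_one hρ0]; exact hr.le
        simp only [zero_div]
        positivity
      · have hb : ‖x (i + 1) - x₀‖ / ρ ≤
            (1 - η * l + η * l * (‖x i - x₀‖ / ρ)) * (‖x i - x₀‖ / ρ) := by
          rw [← mul_div_assoc]
          refine div_le_div_of_nonneg_right (hstep.trans_eq ?_) hρ0.le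
          rw [show M = 2 * l / ρ by rw [← hρM]; field_simp]
          ring
        obtain ⟨k1, k2, k3⟩ := div_one_sub_contract (div_pos hpos hρ0) hlt (mul_pos hη hl)
          hb
        refine ⟨?_, k1, ?_⟩
        · rw [Metric.mem_closedBall, dist_eq_norm] at hmem ⊢
          exact ((div_le_div_iff_of_pos_right hρ0).1 k2).trans hmem
        · refine k3.trans ?_
          rw [pow_succ, ← mul_assoc]
          gcongr
  obtain ⟨h1, h2, h3⟩ := main i
  refine ⟨h1, ?_⟩
  have e1 : ‖x i - x₀‖ / ρ ≤ ‖x i - x₀‖ / ρ / (1 - ‖x i - x₀‖ / ρ) := by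
    refine le_div_self (by positivity) (sub_pos.2 h2) ?_
    have : 0 ≤ ‖x i - x₀‖ / ρ := by positivity
    linarith
  have e2 : ρ * r₀ / (ρ - r₀) = ρ * (r₀ / ρ / (1 - r₀ / ρ)) := by
    have : ρ - r₀ ≠ 0 := (sub_pos.2 hr).ne'
    have h' : 1 - r₀ / ρ ≠ 0 := by
      rw [one_sub_div hρ0.ne']; positivity
    field_simp
  rw [e2, mul_assoc]
  exact (div_le_iff₀' hρ0).1 (e1.trans h3)

end IsDescentRegion

end GradientDescent

/-! ### Quadratic forms of symmetric operators -/

section Spectral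

variable {E : Type*} [NormedAddCommGroup E] [InnerProductSpace ℝ E] [FiniteDimensional ℝ E]

lemma LinearMap.IsSymmetric.mul_norm_sq_le_inner {T : E →ₗ[ℝ] E} (hT : T.IsSymmetric) {c : ℝ}
    (h : ∀ μ, Module.End.HasEigenvalue T μ → c ≤ μ) (v : E) : c * ‖v‖ ^ 2 ≤ inner ℝ v (T v) := by
  have hb := hT.eigenvectorBasis rfl |>.sum_inner_mul_inner v (T v)
  have hn := hT.eigenvectorBasis rfl |>.sum_inner_mul_inner v v
  rw [real_inner_self_eq_norm_sq] at hn
  rw [← hb, ← hn, Finset.mul_sum]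
  refine Finset.sum_le_sum fun i _ => ?_
  have e : inner ℝ (hT.eigenvectorBasis rfl i) (T v) =
      hT.eigenvalues rfl i * inner ℝ (hT.eigenvectorBasis rfl i) v := by
    rw [← hT, hT.apply_eigenvectorBasis, inner_smul_left]; simp
  rw [e, real_inner_comm v]
  have : c ≤ hT.eigenvalues rfl i := h _ (hT.hasEigenvalue_eigenvalues rfl i)
  nlinarith [mul_le_mul_of_nonneg_right this
    (mul_self_nonneg (inner ℝ (hT.eigenvectorBasis rfl i) v : ℝ))]

end Spectral

/-! ### Matrices as operators and forms; extreme singular values and eigenvalues -/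

section MatrixForms

/-- The operator of a matrix between Euclidean spaces. -/
noncomputable def matOp {p q : ℕ} (X : Matrix (Fin p) (Fin q) ℝ) :
    EuclideanSpace ℝ (Fin q) →L[ℝ] EuclideanSpace ℝ (Fin p) :=
  LinearMap.toContinuousLinearMap (Matrix.toEuclideanLin X)

variable {p q r : ℕ}

lemma matOp_apply (X : Matrix (Fin p) (Fin q) ℝ) (v : EuclideanSpace ℝ (Fin q)) :
    matOp X v = WithLp.toLp 2 (X *ᵥ v.ofLp) := rfl

lemma specNorm_nonneg (X : Matrix (Fin p) (Fin q) ℝ) : 0 ≤ specNorm X := norm_nonneg _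

lemma norm_matOp_apply_le (X : Matrix (Fin p) (Fin q) ℝ) (v : EuclideanSpace ℝ (Fin q)) :
    ‖matOp X v‖ ≤ specNorm X * ‖v‖ := (matOp X).le_opNorm v

lemma norm_matOp_apply_le_frobenius (X : Matrix (Fin p) (Fin q) ℝ)
    (v : EuclideanSpace ℝ (Fin q)) : ‖matOp X v‖ ≤ ‖X‖ * ‖v‖ := by
  have h1 := Matrix.frobenius_norm_replicateCol (ι := Unit) (X *ᵥ v.ofLp)
  have h2 := Matrix.frobenius_norm_replicateCol (ι := Unit) v.ofLp
  rw [Matrix.replicateCol_mulVec] at h1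
  rw [matOp_apply, ← h1]
  exact (Matrix.frobenius_norm_mul _ _).trans_eq (by rw [h2])

lemma matOp_mul_apply (X : Matrix (Fin p) (Fin q) ℝ) (Y : Matrix (Fin q) (Fin r) ℝ)
    (v : EuclideanSpace ℝ (Fin r)) : matOp (X * Y) v = matOp X (matOp Y v) := by
  simp [matOp_apply]

lemma matOp_pow_apply (X : Matrix (Fin p) (Fin p) ℝ) (k : ℕ) (v : EuclideanSpace ℝ (Fin p)) :
    (matOp X ^ k) v = matOp (X ^ k) v := by
  induction k generalizing v with
  | zero => simp [matOp_apply]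
  | succ k ih => rw [pow_succ, pow_succ, matOp_mul_apply, ← ih]; rfl

/-- The bilinear form `(u, v) ↦ uᵀ X v` of a matrix. -/
noncomputable def matForm (X : Matrix (Fin p) (Fin p) ℝ) : BilForm (EuclideanSpace ℝ (Fin p)) :=
  (innerForm _).bilinearComp (ContinuousLinearMap.id ℝ _) (matOp X)

lemma matForm_apply_inner (X : Matrix (Fin p) (Fin p) ℝ) (u v : EuclideanSpace ℝ (Fin p)) :
    matForm X u v = inner ℝ u (matOp X v) := rfl

lemma matForm_apply (X : Matrix (Fin p) (Fin p) ℝ) (u v : EuclideanSpace ℝ (Fin p)) :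
    matForm X u v = u.ofLp ⬝ᵥ (X *ᵥ v.ofLp) := by
  rw [matForm_apply_inner, matOp_apply, EuclideanSpace.inner_eq_star_dotProduct]
  simp [dotProduct_comm]

lemma matForm_le (X : Matrix (Fin p) (Fin p) ℝ) (v : EuclideanSpace ℝ (Fin p)) :
    matForm X v v ≤ specNorm X * ‖v‖ ^ 2 := by
  rw [matForm_apply_inner]
  calc _ ≤ ‖v‖ * ‖matOp X v‖ := real_inner_le_norm _ _
    _ ≤ ‖v‖ * (specNorm X * ‖v‖) := by gcongr; exact norm_matOp_apply_le X v
    _ = _ := by ring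

lemma matForm_symm {X : Matrix (Fin p) (Fin p) ℝ} (hX : X.IsHermitian)
    (u v : EuclideanSpace ℝ (Fin p)) : matForm X u v = matForm X v u := by
  rw [matForm_apply, matForm_apply, Matrix.dotProduct_mulVec, ← Matrix.mulVec_transpose,
    dotProduct_comm]
  rw [Matrix.IsHermitian, Matrix.conjTranspose_eq_transpose_of_trivial] at hX
  rw [hX]

lemma matForm_isPSD {X : Matrix (Fin p) (Fin p) ℝ} (hX : X.PosSemidef) : (matForm X).IsPSD where
  symm := matForm_symm hX.1
  nonneg v := by
    rw [matForm_apply]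
    simpa using hX.dotProduct_mulVec_nonneg v.ofLp

/-- For an eigenvalue `μ ≥ 0` of `X`, `μ²` is an eigenvalue of `XᵀX`, hence at least the square of
the last singular value. The quadratic form is bounded below by the smallest eigenvalue. -/
lemma sigmaMin_mul_le {X : Matrix (Fin p) (Fin p) ℝ} (hX : X.PosSemidef)
    (v : EuclideanSpace ℝ (Fin p)) : sigmaMin X * ‖v‖ ^ 2 ≤ matForm X v v := by
  rcases Nat.eq_zero_or_pos p with rfl | hp
  · have : v = 0 := Subsingleton.elim _ _
    simp [this]
  set T := Matrix.toEuclideanLin X with hT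
  have hs : T.IsSymmetric := Matrix.isSymmetric_toEuclideanLin_iff.2 hX.1
  have hfin : Module.finrank ℝ (EuclideanSpace ℝ (Fin p)) = p := by simp
  refine hs.mul_norm_sq_le_inner (fun μ hμ => ?_) v
  obtain ⟨u, hu⟩ := hμ.exists_hasEigenvector
  have hTu : T u = μ • u := hu.apply_eq_smul
  have hμ0 : 0 ≤ μ := by
    have h1 := (matForm_isPSD hX).nonneg u
    have h2 : matForm X u u = μ * ‖u‖ ^ 2 := by
      rw [matForm_apply_inner, show matOp X u = μ • u from hTu, inner_smul_right,
        real_inner_self_eq_norm_sq]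
    rw [h2] at h1
    have : 0 < ‖u‖ ^ 2 := by have := norm_pos_iff.2 hu.2; positivity
    exact nonneg_of_mul_nonneg_left h1 this
  have hadj : LinearMap.adjoint T = T := by
    rw [← LinearMap.isSelfAdjoint_iff'] ; exact (LinearMap.isSymmetric_iff_isSelfAdjoint T).1 hs
  have hev : Module.End.HasEigenvalue (LinearMap.adjoint T ∘ₗ T) (μ ^ 2) := by
    refine Module.End.hasEigenvalue_of_hasEigenvector (x := u)
      (Module.End.hasEigenvector_iff.2 ⟨Module.End.mem_eigenspace_iff.2 ?_, hu.2⟩)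
    rw [hadj, LinearMap.comp_apply, hTu, map_smul, hTu, smul_smul, sq]
  obtain ⟨j, hj⟩ := T.isSymmetric_adjoint_comp_self.exists_eigenvalues_eq hfin hev
  have hlt : p - 1 < p := by omega
  have h2 : sigmaMin X ^ 2 ≤ μ ^ 2 := by
    rw [sigmaMin, T.sq_singularValues_of_lt hfin hlt]
    have h3 : T.isSymmetric_adjoint_comp_self.eigenvalues hfin j = μ ^ 2 := by
      simpa using hj
    rw [← h3]
    exact T.isSymmetric_adjoint_comp_self.eigenvalues_antitone hfin
      (by rw [Fin.le_def]; simp; omega)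
  exact le_of_sq_le_sq h2 hμ0

lemma sigmaMin_pos {X : Matrix (Fin p) (Fin p) ℝ} (hX : X.PosDef) (hp : 0 < p) :
    0 < sigmaMin X := by
  refine LinearMap.injective_iff_forall_lt_finrank_singularValues_pos _ |>.1 ?_ _ (by simp; omega)
  refine (injective_iff_map_eq_zero _).2 fun v hv => ?_
  by_contra hne
  have h1 := hX.dotProduct_mulVec_pos (x := v.ofLp) (by simpa using hne)
  have h2 : matForm X v v = 0 := by
    rw [matForm_apply_inner, show matOp X v = 0 from hv, inner_zero_right]
  rw [matForm_apply] at h2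
  simp [h2] at h1

lemma sigmaMin_le_specNorm {X : Matrix (Fin p) (Fin p) ℝ} (hX : X.PosSemidef) (hp : 0 < p) :
    sigmaMin X ≤ specNorm X := by
  have h1 := (sigmaMin_mul_le hX (EuclideanSpace.single ⟨0, hp⟩ 1)).trans
    (matForm_le X (EuclideanSpace.single ⟨0, hp⟩ 1))
  simpa using h1

lemma lambdaMin_mul_le {ι : Type} [Fintype ι] [DecidableEq ι] {X : Matrix ι ι ℝ}
    (hX : X.IsHermitian) (v : EuclideanSpace ℝ ι) :
    lambdaMin X * ‖v‖ ^ 2 ≤ v.ofLp ⬝ᵥ (X *ᵥ v.ofLp) := by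
  have hs : (Matrix.toEuclideanLin X).IsSymmetric := Matrix.isSymmetric_toEuclideanLin_iff.2 hX
  have := hs.mul_norm_sq_le_inner (c := lambdaMin X) (fun μ hμ => ?_) v
  · rw [EuclideanSpace.inner_eq_star_dotProduct] at this
    simpa [dotProduct_comm] using this
  · refine csInf_le Matrix.finite_real_spectrum.bddBelow ?_
    rw [← Matrix.spectrum_toLpLin 2]
    exact hμ.mem_spectrum

end MatrixForms

/-! ### Spectral radius below one -/

section Stability

variable {n : ℕ}

/-- Gelfand's formula over `ℂ` gives geometric decay; the entrywise embedding of real matrices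
preserves the Frobenius norm. -/
lemma norm_pow_tendsto_zero_of_spectralRadius_lt_one {M : Matrix (Fin n) (Fin n) ℝ}
    (h : spectralRadius ℂ (M.map (algebraMap ℝ ℂ)) < 1) :
    Tendsto (fun k : ℕ => ‖M ^ k‖) atTop (𝓝 0) := by
  have : CompleteSpace (Matrix (Fin n) (Fin n) ℂ) := FiniteDimensional.complete ℂ _
  obtain ⟨r, hr1, hr2⟩ := ENNReal.lt_iff_exists_nnreal_btwn.1 h
  have hg := spectrum.pow_nnnorm_pow_one_div_tendsto_nhds_spectralRadius
    (M.map (algebraMap ℝ ℂ))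
  have hr2' : (r : ℝ) < 1 := by exact_mod_cast hr2
  have hgeom := tendsto_pow_atTop_nhds_zero_of_lt_one r.2 hr2'
  refine squeeze_zero' (Eventually.of_forall fun _ => norm_nonneg _) ?_ hgeom
  filter_upwards [hg.eventually_lt_const hr1, eventually_gt_atTop 0] with k hk hk0
  have e1 : ‖M ^ k‖₊ = ‖(M.map (algebraMap ℝ ℂ)) ^ k‖₊ := by
    rw [← Matrix.map_pow]
    refine (Matrix.frobenius_nnnorm_map_eq _ _ fun a => ?_).symm
    simp
  have e2 := ENNReal.rpow_lt_rpow hk (show (0 : ℝ) < k by positivity)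
  rw [← ENNReal.rpow_mul, one_div, inv_mul_cancel₀ (by positivity), ENNReal.rpow_one,
    ENNReal.rpow_natCast, ← e1] at e2
  have e3 : ‖M ^ k‖₊ < r ^ k := by exact_mod_cast e2
  exact_mod_cast e3.le

lemma powStable_matOp {M : Matrix (Fin n) (Fin n) ℝ}
    (h : spectralRadius ℂ (M.map (algebraMap ℝ ℂ)) < 1) : PowStable (matOp M) := fun v => by
  refine squeeze_zero_norm (fun k => ?_)
    (by simpa using (norm_pow_tendsto_zero_of_spectralRadius_lt_one h).mul_const ‖v‖)
  rw [matOp_pow_apply]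
  exact norm_matOp_apply_le_frobenius _ _

/-- Upper hemicontinuity of the spectrum: the condition says that the spectrum lies in the open unit
disc. -/
lemma isOpen_spectralRadius_lt_one :
    IsOpen {M : Matrix (Fin n) (Fin n) ℂ | spectralRadius ℂ M < 1} := by
  have : CompleteSpace (Matrix (Fin n) (Fin n) ℂ) := FiniteDimensional.complete ℂ _
  have hiff : ∀ M : Matrix (Fin n) (Fin n) ℂ,
      spectralRadius ℂ M < 1 ↔ spectrum ℂ M ⊆ Metric.ball 0 1 := by
    intro M
    constructor
    · intro h k hk
      have : (‖k‖₊ : ℝ≥0∞) < 1 := lt_of_le_of_lt (le_iSup₂ (f := fun k _ => (‖k‖₊ : ℝ≥0∞)) k hk) h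
      rw [mem_ball_zero_iff]
      exact_mod_cast this
    · intro h
      rcases (spectrum ℂ M).eq_empty_or_nonempty with he | hne
      · simp [spectralRadius, he]
      · refine spectrum.spectralRadius_lt_of_forall_lt_of_nonempty (r := 1) hne fun k hk => ?_
        have := h hk
        rw [mem_ball_zero_iff] at this
        exact_mod_cast this
  simp only [hiff]
  exact upperHemicontinuous_iff_isOpen_preimage_Iic.1 (upperHemicontinuous_spectrum ℂ _) _
    Metric.isOpen_ball

end Stability

/-! ### Passage between gains and their vectors of entries -/

section Vectorization

variable {m d : ℕ}

/-- The matrix with given vector of entries. -/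
noncomputable def unvec (m d : ℕ) :
    EuclideanSpace ℝ (Fin m × Fin d) ≃L[ℝ] Matrix (Fin m) (Fin d) ℝ :=
  (((WithLp.linearEquiv 2 ℝ (Fin m × Fin d → ℝ)).trans
    (LinearEquiv.curry ℝ ℝ (Fin m) (Fin d))).trans
      (Matrix.ofLinearEquiv ℝ)).toContinuousLinearEquiv

lemma unvec_apply (z : EuclideanSpace ℝ (Fin m × Fin d)) (i : Fin m) (j : Fin d) :
    unvec m d z i j = z (i, j) := rfl

lemma norm_unvec (z : EuclideanSpace ℝ (Fin m × Fin d)) : ‖unvec m d z‖ = ‖z‖ := by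
  rw [Matrix.frobenius_norm_def, EuclideanSpace.norm_eq, Real.sqrt_eq_rpow, Fintype.sum_prod_type]
  simp [unvec_apply]

lemma unvec_single (p : Fin m × Fin d) :
    unvec m d (EuclideanSpace.single p 1) = Matrix.single p.1 p.2 1 := by
  ext i j
  simp only [unvec_apply, Matrix.single_apply, PiLp.single_apply, Prod.ext_iff]
  simp only [eq_comm]

lemma dirDeriv_comp_unvec (F : Matrix (Fin m) (Fin d) ℝ → ℝ)
    (z : EuclideanSpace ℝ (Fin m × Fin d)) (k : EuclideanSpace ℝ (Fin m × Fin d)) :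
    dirDeriv z (fun k => F (unvec m d k)) k = fderiv ℝ F (unvec m d k) (unvec m d z) :=
  DFunLike.congr_fun ((unvec m d).comp_right_fderiv (f := F) (x := k)) z

lemma matrixGradient_apply (F : Matrix (Fin m) (Fin d) ℝ → ℝ)
    (k : EuclideanSpace ℝ (Fin m × Fin d)) (i : Fin m) (j : Fin d) :
    matrixGradient F (unvec m d k) i j =
      dirDeriv (EuclideanSpace.single (i, j) 1) (fun k => F (unvec m d k)) k := by
  rw [dirDeriv_comp_unvec, unvec_single]; rfl

lemma EuclideanSpace.sum_smul_single {ι : Type*} [Fintype ι] [DecidableEq ι]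
    (z : EuclideanSpace ℝ ι) : ∑ p, z p • EuclideanSpace.single p (1 : ℝ) = z := by
  simpa using (EuclideanSpace.basisFun ι ℝ).sum_repr z

lemma bilForm_apply_eq_sum {ι : Type*} [Fintype ι] [DecidableEq ι]
    (X : BilForm (EuclideanSpace ℝ ι)) (u v : EuclideanSpace ℝ ι) :
    X u v = ∑ i, ∑ j, u i * v j *
      X (EuclideanSpace.single i 1) (EuclideanSpace.single j 1) := by
  conv_lhs => rw [← EuclideanSpace.sum_smul_single u, ← EuclideanSpace.sum_smul_single v]
  simp only [map_sum, map_smul, _root_.sum_apply, _root_.smul_apply, smul_eq_mul,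
    Finset.mul_sum]
  rw [Finset.sum_comm]
  exact Finset.sum_congr rfl fun i _ => Finset.sum_congr rfl fun j _ => by ring

/-- The matrix of partial derivatives represents the derivative for the Frobenius inner product, so
a gradient step can be tested against any direction. -/
lemma inner_matrixGradient (F : Matrix (Fin m) (Fin d) ℝ → ℝ)
    (k w : EuclideanSpace ℝ (Fin m × Fin d)) :
    inner ℝ w ((unvec m d).symm (matrixGradient F (unvec m d k))) =
      dirDeriv w (fun k => F (unvec m d k)) k := by
  conv_rhs => rw [← EuclideanSpace.sum_smul_single w, dirDeriv, map_sum]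
  rw [EuclideanSpace.inner_eq_star_dotProduct, dotProduct]
  refine Finset.sum_congr rfl fun p _ => ?_
  have h1 : ((unvec m d).symm (matrixGradient F (unvec m d k))) p =
      matrixGradient F (unvec m d k) p.1 p.2 := by
    rw [← unvec_apply, ContinuousLinearEquiv.apply_symm_apply]
  change ((unvec m d).symm (matrixGradient F (unvec m d k))) p * star (w p) = _
  rw [h1, matrixGradient_apply, dirDeriv, map_smul]
  simp [mul_comm]

lemma matrixHessian_apply (F : Matrix (Fin m) (Fin d) ℝ → ℝ)
    (k : EuclideanSpace ℝ (Fin m × Fin d)) (p q : Fin m × Fin d) :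
    matrixHessian F (unvec m d k) p q =
      dirDeriv (EuclideanSpace.single p 1) (dirDeriv (EuclideanSpace.single q 1)
        (fun k => F (unvec m d k))) k := by
  have : dirDeriv (EuclideanSpace.single q 1) (fun k => F (unvec m d k)) =
      fun k => (fun K' => fderiv ℝ F K' (Matrix.single q.1 q.2 1)) (unvec m d k) := by
    funext k
    rw [dirDeriv_comp_unvec, unvec_single]
  rw [this, dirDeriv_comp_unvec (fun K' => fderiv ℝ F K' (Matrix.single q.1 q.2 1)), unvec_single]
  rfl

end Vectorization

/-! ### The cost as a second moment of the value form -/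

namespace SOF

variable {n m d : ℕ} (S : SOF n m d)

lemma isOpen_stabilizing : IsOpen S.stabilizing := by
  have : Continuous fun K => (S.closedLoop K).map (algebraMap ℝ ℂ) := by
    refine Continuous.matrix_map ?_ (by simpa using Complex.continuous_ofReal)
    unfold closedLoop
    fun_prop
  exact isOpen_spectralRadius_lt_one.preimage this

/-- The functional `X ↦ tr(X X₀)` on bilinear forms. -/
noncomputable def moment : BilForm (EuclideanSpace ℝ (Fin n)) →L[ℝ] ℝ :=
  LinearMap.toContinuousLinearMap
    { toFun := fun X : BilForm (EuclideanSpace ℝ (Fin n)) =>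
        ∑ i, ∑ j, S.X0 i j * X (EuclideanSpace.single i 1) (EuclideanSpace.single j 1)
      map_add' := fun X Y => by simp [mul_add, Finset.sum_add_distrib]
      map_smul' := fun c X => by simp [Finset.mul_sum, mul_left_comm] }

lemma moment_apply (X : BilForm (EuclideanSpace ℝ (Fin n))) :
    S.moment X = ∑ i, ∑ j, S.X0 i j * X (EuclideanSpace.single i 1) (EuclideanSpace.single j 1) :=
  rfl

lemma integrable_mul (hD : ∀ i, MemLp (fun x : Fin n → ℝ => x i) 2 S.D) (i j : Fin n) :
    Integrable (fun x : Fin n → ℝ => x i * x j) S.D :=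
  (hD i).integrable_mul (hD j)

lemma integrable_form (hD : ∀ i, MemLp (fun x : Fin n → ℝ => x i) 2 S.D)
    (X : BilForm (EuclideanSpace ℝ (Fin n))) :
    Integrable (fun x : Fin n → ℝ => X (WithLp.toLp 2 x) (WithLp.toLp 2 x)) S.D := by
  rw [funext fun x : Fin n → ℝ => bilForm_apply_eq_sum X (WithLp.toLp 2 x) (WithLp.toLp 2 x)]
  exact integrable_finsetSum _ fun i _ => integrable_finsetSum _ fun j _ =>
    (S.integrable_mul hD i j).mul_const _

lemma moment_eq_integral (hD : ∀ i, MemLp (fun x : Fin n → ℝ => x i) 2 S.D)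
    (X : BilForm (EuclideanSpace ℝ (Fin n))) :
    S.moment X = ∫ x, X (WithLp.toLp 2 x) (WithLp.toLp 2 x) ∂S.D := by
  rw [funext fun x : Fin n → ℝ => bilForm_apply_eq_sum X (WithLp.toLp 2 x) (WithLp.toLp 2 x),
    moment_apply, integral_finsetSum _ fun i _ => integrable_finsetSum _ fun j _ =>
    (S.integrable_mul hD i j).mul_const _]
  refine Finset.sum_congr rfl fun i _ => ?_
  rw [integral_finsetSum _ fun j _ => (S.integrable_mul hD i j).mul_const _]
  refine Finset.sum_congr rfl fun j _ => ?_
  rw [integral_mul_const]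
  rfl

lemma moment_mono (hD : ∀ i, MemLp (fun x : Fin n → ℝ => x i) 2 S.D)
    {X Y : BilForm (EuclideanSpace ℝ (Fin n))} (h : ∀ v, X v v ≤ Y v v) :
    S.moment X ≤ S.moment Y := by
  rw [S.moment_eq_integral hD, S.moment_eq_integral hD]
  exact integral_mono (S.integrable_form hD X) (S.integrable_form hD Y) fun x => h _

lemma abs_moment_le (hD : ∀ i, MemLp (fun x : Fin n → ℝ => x i) 2 S.D)
    {X Y : BilForm (EuclideanSpace ℝ (Fin n))} {s : ℝ} (h : ∀ v, |X v v| ≤ s * Y v v) :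
    |S.moment X| ≤ s * S.moment Y := by
  have h1 := S.moment_mono hD (X := X) (Y := s • Y) fun v => (le_abs_self _).trans (h v)
  have h2 := S.moment_mono hD (X := (-1 : ℝ) • X) (Y := s • Y) fun v => by
    simpa using (neg_le_abs _).trans (h v)
  rw [map_smul, smul_eq_mul] at h1
  rw [map_smul, map_smul, smul_eq_mul, smul_eq_mul] at h2
  exact abs_le'.2 ⟨h1, by linarith⟩

lemma moment_rank_one (a : EuclideanSpace ℝ (Fin n) →L[ℝ] ℝ) :
    S.moment (a.smulRight a) = (fun i => a (EuclideanSpace.single i 1)) ⬝ᵥ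
      (S.X0 *ᵥ fun i => a (EuclideanSpace.single i 1)) := by
  rw [moment_apply, dotProduct]
  refine Finset.sum_congr rfl fun i _ => ?_
  rw [Matrix.mulVec, dotProduct, Finset.mul_sum]
  refine Finset.sum_congr rfl fun j _ => ?_
  simp
  ring

lemma posSemidef_X0 (hD : ∀ i, MemLp (fun x : Fin n → ℝ => x i) 2 S.D) :
    S.X0.PosSemidef := by
  refine Matrix.PosSemidef.of_dotProduct_mulVec_nonneg ?_ fun w => ?_
  · ext i j
    simp [X0, mul_comm]
  · have h1 := S.moment_rank_one (innerForm _ (WithLp.toLp 2 w))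
    have h2 : (fun i => innerForm _ (WithLp.toLp 2 w)
        (EuclideanSpace.single i (1 : ℝ))) = w := by
      funext i
      simp [innerForm_apply, EuclideanSpace.inner_single_right]
    rw [h2] at h1
    simp only [star_trivial]
    rw [← h1, S.moment_eq_integral hD]
    exact integral_nonneg fun x => by simpa using mul_self_nonneg _

/-- Cauchy-Schwarz for `P` bounds the rank-one form `P(v,·)⊗P(v,·)` by `P(v,v) P`. Its moment is at
least `μ‖w‖²`, with `w` the vector representing `P(v,·)`, and `P(v,v) ≤ ‖v‖‖w‖`; cancelling one
factor `P(v,v)` gives the claim. -/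
lemma mu_mul_le_moment (hD : ∀ i, MemLp (fun x : Fin n → ℝ => x i) 2 S.D) (hμ : 0 < S.mu)
    {P : BilForm (EuclideanSpace ℝ (Fin n))} (hP : P.IsPSD) (v : EuclideanSpace ℝ (Fin n)) :
    S.mu * P v v ≤ S.moment P * ‖v‖ ^ 2 := by
  set w : EuclideanSpace ℝ (Fin n) := WithLp.toLp 2 fun i => P v (EuclideanSpace.single i 1)
  have h1 : S.mu * ‖w‖ ^ 2 ≤ S.moment ((P v).smulRight (P v)) := by
    rw [moment_rank_one]
    have := sigmaMin_mul_le (S.posSemidef_X0 hD) w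
    rwa [matForm_apply] at this
  have h2 : S.moment ((P v).smulRight (P v)) ≤ P v v * S.moment P := by
    have := S.moment_mono hD (X := (P v).smulRight (P v)) (Y := P v v • P) fun x => by
      have hcs := LinearMap.BilinForm.apply_sq_le_of_symm
        (ContinuousLinearMap.toLinearMap₁₂ P) (fun x => hP.nonneg x) ⟨fun x y => hP.symm x y⟩ v x
      simpa [sq] using hcs
    simpa using this
  have h3 : P v v = inner ℝ v w := by
    conv_lhs => enter [2]; rw [← EuclideanSpace.sum_smul_single v]
    rw [EuclideanSpace.inner_eq_star_dotProduct, dotProduct, map_sum]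
    exact Finset.sum_congr rfl fun i _ => by simp [w, mul_comm]
  have h4 : P v v ^ 2 ≤ ‖v‖ ^ 2 * ‖w‖ ^ 2 := by
    rw [h3, ← mul_pow]
    exact sq_le_sq.2 (by
      rw [abs_of_nonneg (mul_nonneg (norm_nonneg v) (norm_nonneg w))]
      exact abs_real_inner_le_norm v w)
  rcases (hP.nonneg v).eq_or_lt with h0 | h0
  · rw [← h0, mul_zero]
    have : 0 ≤ S.moment P := by
      rw [S.moment_eq_integral hD]
      exact integral_nonneg fun x => hP.nonneg _
    positivity
  · refine le_of_mul_le_mul_right ?_ h0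
    have h5 := mul_le_mul_of_nonneg_left h4 hμ.le
    have h6 := mul_le_mul_of_nonneg_left (h1.trans h2) (sq_nonneg ‖v‖)
    linarith

section Cost

/-- The feedback `x ↦ K C x`, as a function of the vector of entries of `K`. -/
noncomputable def feedback : EuclideanSpace ℝ (Fin m × Fin d) →L[ℝ]
    EuclideanSpace ℝ (Fin n) →L[ℝ] EuclideanSpace ℝ (Fin m) :=
  LinearMap.toContinuousLinearMap
    { toFun := fun k => matOp (unvec m d k * S.C)
      map_add' := fun k k' => by ext; simp [matOp_apply, Matrix.add_mul, Matrix.add_mulVec]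
      map_smul' := fun c k => by ext; simp [matOp_apply, Matrix.smul_mulVec] }

lemma feedback_apply (k : EuclideanSpace ℝ (Fin m × Fin d)) (v : EuclideanSpace ℝ (Fin n)) :
    S.feedback k v = matOp (unvec m d k) (matOp S.C v) := matOp_mul_apply _ _ _

lemma loopMap_feedback (k : EuclideanSpace ℝ (Fin m × Fin d)) :
    loopMap (matOp S.A) (matOp S.B) S.feedback k = matOp (S.closedLoop (unvec m d k)) := by
  ext v : 1
  simp [loopMap, feedback_apply, matOp_apply, closedLoop, Matrix.sub_mulVec,
    Matrix.mul_assoc]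

lemma toLp_input (k : EuclideanSpace ℝ (Fin m × Fin d)) (x : Fin n → ℝ) :
    WithLp.toLp 2 (S.input (unvec m d k) x) = -S.feedback k (WithLp.toLp 2 x) := by
  rw [feedback_apply]
  simp [input, matOp_apply]

lemma toLp_state (k : EuclideanSpace ℝ (Fin m × Fin d)) (x : Fin n → ℝ) (t : ℕ) :
    WithLp.toLp 2 (S.state (unvec m d k) x t) =
      (loopMap (matOp S.A) (matOp S.B) S.feedback k ^ t) (WithLp.toLp 2 x) := by
  induction t with
  | zero => simp [state]
  | succ t ih =>
    rw [pow_succ', mul_apply_eq_comp, ← ih, loopMap_feedback]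
    simp [state, input, matOp_apply, closedLoop, Matrix.sub_mulVec, Matrix.mulVec_neg,
      Matrix.mul_assoc, ← sub_eq_add_neg]

lemma stageCost_eq (k : EuclideanSpace ℝ (Fin m × Fin d)) (x : Fin n → ℝ) :
    S.stageCost (unvec m d k) x = matForm S.Q (WithLp.toLp 2 x) (WithLp.toLp 2 x) +
      matForm S.R (S.feedback k (WithLp.toLp 2 x)) (S.feedback k (WithLp.toLp 2 x)) := by
  have h : matForm S.R (S.feedback k (WithLp.toLp 2 x)) (S.feedback k (WithLp.toLp 2 x)) =
      matForm S.R (-S.feedback k (WithLp.toLp 2 x)) (-S.feedback k (WithLp.toLp 2 x)) := by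
    simp
  rw [h, ← toLp_input, matForm_apply, matForm_apply]
  rfl

/-- The cost is the second moment of the solution of the Lyapunov equation. -/
lemma J_eq_moment (hD : ∀ i, MemLp (fun x : Fin n → ℝ => x i) 2 S.D) (hQ : S.Q.PosSemidef)
    (hR : S.R.PosSemidef) {k : EuclideanSpace ℝ (Fin m × Fin d)}
    (hk : unvec m d k ∈ S.stabilizing) {P : BilForm (EuclideanSpace ℝ (Fin n))}
    (hP : ∀ v, P v v - P (loopMap (matOp S.A) (matOp S.B) S.feedback k v)
        (loopMap (matOp S.A) (matOp S.B) S.feedback k v) =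
      matForm S.Q v v + matForm S.R (S.feedback k v) (S.feedback k v)) :
    S.J (unvec m d k) = S.moment P := by
  have hstab : PowStable (loopMap (matOp S.A) (matOp S.B) S.feedback k) := by
    rw [loopMap_feedback]; exact powStable_matOp hk
  rw [J, S.moment_eq_integral hD]
  congr 1
  funext x
  set v := WithLp.toLp 2 x with hv
  set M := loopMap (matOp S.A) (matOp S.B) S.feedback k with hM
  -- By the Lyapunov equation the stage costs telescope, and stability kills the remainder.
  have hterm : ∀ t, S.stageCost (unvec m d k) (S.state (unvec m d k) x t) =
      P ((M ^ t) v) ((M ^ t) v) - P ((M ^ (t + 1)) v) ((M ^ (t + 1)) v) := by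
    intro t
    rw [stageCost_eq, toLp_state, ← hP, pow_succ']
    rfl
  refine HasSum.tsum_eq ?_
  rw [hasSum_iff_tendsto_nat_of_nonneg]
  · have h1 := (hstab.tendsto_apply P v v).const_sub (P v v)
    rw [sub_zero] at h1
    refine h1.congr fun N => ?_
    simp only [hterm]
    rw [Finset.sum_range_sub' (fun t => P ((M ^ t) v) ((M ^ t) v))]
    simp
  · intro t
    rw [stageCost_eq]
    exact add_nonneg ((matForm_isPSD hQ).nonneg _) ((matForm_isPSD hR).nonneg _)

end Cost

end SOF

/-! ### Reduction of derivative bounds to directions of norm at most one -/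

section Homogeneity

variable {E F : Type*} [NormedAddCommGroup E] [NormedSpace ℝ E]
  [NormedAddCommGroup F] [NormedSpace ℝ F]

lemma dirDeriv_smul (a : ℝ) (z : E) (g : E → F) : dirDeriv (a • z) g = a • dirDeriv z g := by
  funext k
  simp [dirDeriv]

lemma dirDeriv_const_smul (a : ℝ) (z : E) (g : E → F) :
    dirDeriv z (a • g) = a • dirDeriv z g := by
  funext k
  simp [dirDeriv, fderiv_const_smul_field]

lemma exists_smul_norm_le_one (z : E) : ∃ w : E, ‖w‖ ≤ 1 ∧ z = ‖z‖ • w := by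
  rcases eq_or_ne z 0 with rfl | hz
  · exact ⟨0, by simp, by simp⟩
  · refine ⟨‖z‖⁻¹ • z, ?_, ?_⟩
    · rw [norm_smul, norm_inv, norm_norm, inv_mul_cancel₀ (norm_ne_zero_iff.2 hz)]
    · rw [smul_smul, mul_inv_cancel₀ (norm_ne_zero_iff.2 hz), one_smul]

lemma second_le_of_le_of_norm_le_one {f : E → ℝ} {k : E} {L : ℝ}
    (h : ∀ z, ‖z‖ ≤ 1 → dirDeriv z (dirDeriv z f) k ≤ L) (z : E) :
    dirDeriv z (dirDeriv z f) k ≤ L * ‖z‖ ^ 2 := by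
  obtain ⟨w, hw, hz⟩ := exists_smul_norm_le_one z
  have e : dirDeriv z (dirDeriv z f) k = ‖z‖ ^ 2 * dirDeriv w (dirDeriv w f) k := by
    conv_lhs => rw [hz]
    simp only [dirDeriv_smul, dirDeriv_const_smul, Pi.smul_apply, smul_eq_mul]
    ring
  rw [e, mul_comm L]
  exact mul_le_mul_of_nonneg_left (h w hw) (sq_nonneg _)

lemma third_le_of_le_of_norm_le_one {f : E → ℝ} {k : E} {M : ℝ}
    (h : ∀ z e, ‖z‖ ≤ 1 → ‖e‖ ≤ 1 → |dirDeriv e (dirDeriv z (dirDeriv z f)) k| ≤ M) (z e : E) :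
    |dirDeriv e (dirDeriv z (dirDeriv z f)) k| ≤ M * ‖z‖ ^ 2 * ‖e‖ := by
  obtain ⟨w, hw, hz⟩ := exists_smul_norm_le_one z
  obtain ⟨u, hu, he⟩ := exists_smul_norm_le_one e
  have eq : dirDeriv e (dirDeriv z (dirDeriv z f)) k =
      (‖z‖ ^ 2 * ‖e‖) * dirDeriv u (dirDeriv w (dirDeriv w f)) k := by
    conv_lhs => rw [hz, he]
    simp only [dirDeriv_smul, dirDeriv_const_smul, Pi.smul_apply, smul_eq_mul]
    ring
  rw [eq, abs_mul, abs_of_nonneg (by positivity), mul_assoc M, mul_comm M]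
  exact mul_le_mul_of_nonneg_left (h w u hw hu) (by positivity)

end Homogeneity

/-! ### Uniform bounds on a sublevel set and the explicit constants -/

namespace SOF

variable {n m d : ℕ} (S : SOF n m d)

/-- The vectorized stabilizing set. -/
def vecStabilizing : Set (EuclideanSpace ℝ (Fin m × Fin d)) := unvec m d ⁻¹' S.stabilizing

/-- `P` is the family of solutions of the Lyapunov equations of the stabilizing gains. -/
abbrev IsValueFamily (P : EuclideanSpace ℝ (Fin m × Fin d) → BilForm (EuclideanSpace ℝ (Fin n))) :
    Prop :=
  IsLyapunovFamily (matOp S.A) (matOp S.B) S.feedback (matForm S.Q) (matForm S.R)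
    S.vecStabilizing P

lemma exists_isValueFamily (hQ : S.Q.PosDef) (hR : S.R.PosDef) : ∃ P, S.IsValueFamily P := by
  refine exists_isLyapunovFamily (S.isOpen_stabilizing.preimage (unvec m d).continuous)
    (fun k hk => ?_) (matForm_symm hQ.1) (matForm_symm hR.1)
  rw [loopMap_feedback]
  exact powStable_matOp hk

section Bounds

variable {S} {P : EuclideanSpace ℝ (Fin m × Fin d) → BilForm (EuclideanSpace ℝ (Fin n))}
  {α : ℝ} {k z e : EuclideanSpace ℝ (Fin m × Fin d)}

lemma J_eq_of_isValueFamily (hP : S.IsValueFamily P)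
    (hD : ∀ i, MemLp (fun x : Fin n → ℝ => x i) 2 S.D) (hQ : S.Q.PosDef) (hR : S.R.PosDef)
    (hk : k ∈ S.vecStabilizing) : S.J (unvec m d k) = S.moment (P k) :=
  S.J_eq_moment hD hQ.posSemidef hR.posSemidef hk fun v => hP.eq k hk v v

/-- The upper bound `π = α/μ` comes from `mu_mul_le_moment`, since the moment of the value form is
the cost. -/
lemma isLyapunov_of_mem_sublevel (hP : S.IsValueFamily P)
    (hD : ∀ i, MemLp (fun x : Fin n → ℝ => x i) 2 S.D) (hQ : S.Q.PosDef) (hR : S.R.PosDef)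
    (hμ : 0 < S.mu) (hn : 0 < n) (hk : unvec m d k ∈ S.sublevel α) :
    IsLyapunov (loopMap (matOp S.A) (matOp S.B) S.feedback k) (P k) (matForm S.Q) (matForm S.R)
      (S.feedback k) (sigmaMin S.Q) (α / S.mu) := by
  have hstab : PowStable (loopMap (matOp S.A) (matOp S.B) S.feedback k) := by
    rw [loopMap_feedback]; exact powStable_matOp hk.1
  have hRpsd := matForm_isPSD hR.posSemidef
  have hpsd : (P k).IsPSD :=
    { symm := hP.symm k hk.1
      nonneg := hstab.nonneg fun v => by
        have h1 := hP.eq k hk.1 v v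
        have h2 := (matForm_isPSD hQ.posSemidef).nonneg v
        have h3 := hRpsd.nonneg (S.feedback k v)
        linarith }
  refine ⟨hstab, sigmaMin_pos hQ hn, sigmaMin_mul_le hQ.posSemidef, hRpsd, hpsd.symm,
    hP.eq k hk.1, fun v => ?_⟩
  have h1 := S.mu_mul_le_moment hD hμ hpsd v
  rw [← J_eq_of_isValueFamily hP hD hQ hR hk.1] at h1
  rw [div_mul_eq_mul_div, le_div_iff₀ hμ, mul_comm]
  exact h1.trans (mul_le_mul_of_nonneg_right hk.2 (sq_nonneg _))

lemma norm_feedback_apply_le (hz : ‖z‖ ≤ 1) (v : EuclideanSpace ℝ (Fin n)) :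
    ‖S.feedback z v‖ ≤ specNorm S.C * ‖v‖ := by
  rw [feedback_apply]
  have h1 := norm_matOp_apply_le_frobenius (unvec m d z) (matOp S.C v)
  rw [norm_unvec] at h1
  calc _ ≤ ‖z‖ * ‖matOp S.C v‖ := h1
    _ ≤ 1 * ‖matOp S.C v‖ := by gcongr
    _ ≤ _ := by rw [one_mul]; exact norm_matOp_apply_le _ _

lemma isDirBound (hz : ‖z‖ ≤ 1) :
    IsDirBound (matForm S.R) (S.feedback z) (loopDir (matOp S.B) S.feedback z)
      (specNorm S.C ^ 2 * specNorm S.R) (specNorm S.C * specNorm S.B) where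
  feed v := by
    calc _ ≤ specNorm S.R * ‖S.feedback z v‖ ^ 2 := matForm_le _ _
      _ ≤ specNorm S.R * (specNorm S.C * ‖v‖) ^ 2 := by
        gcongr
        · exact specNorm_nonneg _
        · exact norm_feedback_apply_le hz v
      _ = _ := by ring
  loop v := by
    have h1 : loopDir (matOp S.B) S.feedback z v = -matOp S.B (S.feedback z v) := rfl
    rw [h1, norm_neg]
    calc _ ≤ specNorm S.B * ‖S.feedback z v‖ := norm_matOp_apply_le _ _
      _ ≤ specNorm S.B * (specNorm S.C * ‖v‖) := by
        gcongr
        · exact specNorm_nonneg _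
        · exact norm_feedback_apply_le hz v
      _ = _ := by ring

/-- The real supremum is meaningful only for a set bounded above. Boundedness holds because
`σ_min(R)‖KCx‖² ≤ P_K(x,x) ≤ (α/μ)‖x‖²`. -/
lemma specNorm_closedLoop_le_gamma (hP : S.IsValueFamily P)
    (hD : ∀ i, MemLp (fun x : Fin n → ℝ => x i) 2 S.D) (hQ : S.Q.PosDef) (hR : S.R.PosDef)
    (hμ : 0 < S.mu) (hn : 0 < n) (hm : 0 < m) (hα : 0 ≤ α) {K : Matrix (Fin m) (Fin d) ℝ}
    (hK : K ∈ S.sublevel α) : specNorm (S.closedLoop K) ≤ S.gamma α := by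
  refine le_csSup ?_ ⟨K, hK, rfl⟩
  have hσ := sigmaMin_pos hR hm
  refine ⟨specNorm S.A + specNorm S.B * √(α / S.mu / sigmaMin S.R), ?_⟩
  rintro _ ⟨K, hK, rfl⟩
  obtain ⟨k, rfl⟩ := (unvec m d).surjective K
  have h := isLyapunov_of_mem_sublevel hP hD hQ hR hμ hn hK
  have hb := Real.sqrt_nonneg (α / S.mu / sigmaMin S.R)
  refine (matOp (S.closedLoop (unvec m d k))).opNorm_le_bound
    (add_nonneg (specNorm_nonneg _) (mul_nonneg (specNorm_nonneg _) hb)) fun v => ?_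
  have hG : ‖S.feedback k v‖ ≤ √(α / S.mu / sigmaMin S.R) * ‖v‖ := by
    refine abs_le_of_sq_le_sq' ?_ (mul_nonneg hb (norm_nonneg _)) |>.2
    rw [mul_pow, Real.sq_sqrt (by positivity), div_mul_eq_mul_div, le_div_iff₀ hσ, mul_comm]
    have h1 := sigmaMin_mul_le hR.posSemidef (S.feedback k v)
    have h2 := h.le_self v
    have h3 := h.le_pi v
    have h4 := (matForm_isPSD hQ.posSemidef).nonneg v
    linarith
  rw [← loopMap_feedback]
  change ‖matOp S.A v - matOp S.B (S.feedback k v)‖ ≤ _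
  calc _ ≤ ‖matOp S.A v‖ + ‖matOp S.B (S.feedback k v)‖ := norm_sub_le _ _
    _ ≤ specNorm S.A * ‖v‖ + specNorm S.B * (√(α / S.mu / sigmaMin S.R) * ‖v‖) := by
      gcongr
      · exact norm_matOp_apply_le _ _
      · exact (norm_matOp_apply_le _ _).trans
          (mul_le_mul_of_nonneg_left hG (specNorm_nonneg _))
    _ = _ := by ring

end Bounds

section Constants

lemma zeta1_eq (α : ℝ) : S.zeta1 α =
    (specNorm S.C ^ 2 * specNorm S.R + (specNorm S.C * specNorm S.B) ^ 2 * (α / S.mu)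
      + α / S.mu) / sigmaMin S.Q - 1 := by
  rw [zeta1]; ring

/-- The second summand of `q₃` is discarded, and `σ_min(R) ≤ ‖R‖` turns `‖R‖ q₃` into the square
root of the balanced bound. -/
lemma le_zeta2 {α : ℝ} (hα : 0 ≤ α) (hμ : 0 < S.mu) (hQ : 0 < sigmaMin S.Q)
    (hR : 0 < sigmaMin S.R) (hRR : sigmaMin S.R ≤ specNorm S.R) :
    2 * √((specNorm S.C ^ 2 * specNorm S.R + (specNorm S.C * specNorm S.B) ^ 2 * (α / S.mu))
        * (α / S.mu)) / sigmaMin S.Q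
      + 2 * (specNorm S.C * specNorm S.B * (α / S.mu) * S.gamma α) / sigmaMin S.Q
      ≤ S.zeta2 α := by
  have hA := specNorm_nonneg S.A
  have hB := specNorm_nonneg S.B
  have hC := specNorm_nonneg S.C
  set s := √(specNorm S.R * α + specNorm S.B ^ 2 * α ^ 2 / S.mu) / √S.mu with hs
  have hs0 : 0 ≤ s := by positivity
  have h1 : √((specNorm S.C ^ 2 * specNorm S.R
      + (specNorm S.C * specNorm S.B) ^ 2 * (α / S.mu)) * (α / S.mu)) = specNorm S.C * s := by
    rw [hs, ← Real.sqrt_div' _ hμ.le, ← Real.sqrt_sq hC, ← Real.sqrt_mul (sq_nonneg _),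
      Real.sqrt_sq hC]
    congr 1
    field_simp
  have h2 : s ≤ specNorm S.R * S.q3 α := by
    have e1 : S.q3 α = s / sigmaMin S.R
        + specNorm S.B * specNorm S.A * α / (S.mu * sigmaMin S.R) := by
      rw [q3, hs, div_div]
    have e2 : s / sigmaMin S.R ≤ S.q3 α := by
      rw [e1]
      have : 0 ≤ specNorm S.B * specNorm S.A * α / (S.mu * sigmaMin S.R) := by positivity
      linarith
    calc s = sigmaMin S.R * (s / sigmaMin S.R) := by field_simp
      _ ≤ specNorm S.R * S.q3 α := mul_le_mul hRR e2 (by positivity) (hR.le.trans hRR)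
  rw [h1, zeta2, ← add_div, div_mul_eq_mul_div]
  refine div_le_div_of_nonneg_right ?_ hQ.le
  have := mul_le_mul_of_nonneg_left h2 hC
  linarith

lemma smoothConst_eq {α : ℝ} (hκ : specNorm S.C * specNorm S.B ≠ 0) : S.smoothConst α =
    (2 * (specNorm S.C ^ 2 * specNorm S.R + (specNorm S.C * specNorm S.B) ^ 2 * (α / S.mu))
      + 4 * (specNorm S.C * specNorm S.B * S.zeta1 α * (α / S.mu))) / sigmaMin S.Q * α := by
  have hC := left_ne_zero_of_mul hκ
  have hB := right_ne_zero_of_mul hκ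
  rw [smoothConst]
  have e : 2 * S.zeta1 α / (specNorm S.C * specNorm S.B) * (specNorm S.C * specNorm S.B) =
    2 * S.zeta1 α := div_mul_cancel₀ _ hκ
  generalize 2 * S.zeta1 α / (specNorm S.C * specNorm S.B) = x at e
  have e' : 4 * (specNorm S.C * specNorm S.B * S.zeta1 α * (α / S.mu)) =
      2 * (specNorm S.C * specNorm S.B) * (2 * S.zeta1 α) * (α / S.mu) := by ring
  rw [e', ← e]
  ring

/-- The third derivative bound contains `12p` where `4ζ₃ + 2ζ₄` provides `6ζ₁ + 4ζ₂`. Splitting `12p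
= 6p + 6p` and using `p ≤ ζ₁` on one half and `p ≤ 2ζ₂/3` on the other closes the gap. -/
lemma le_hessianLipConst {α p : ℝ} (hα : 0 ≤ α) (hμ : 0 < S.mu) (hQ : 0 < sigmaMin S.Q)
    (hγ : 0 ≤ S.gamma α) (hp0 : 0 ≤ p) (hp1 : p ≤ S.zeta1 α) (hp2 : 3 * p ≤ 2 * S.zeta2 α) :
    (6 * (specNorm S.C * specNorm S.B * (2 * (specNorm S.C ^ 2 * specNorm S.R
        + (specNorm S.C * specNorm S.B) ^ 2 * (α / S.mu)
        + 2 * (specNorm S.C * specNorm S.B * S.gamma α * p * (α / S.mu))) / sigmaMin S.Q)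
        * (α / S.mu))
      + 6 * ((specNorm S.C * specNorm S.B) ^ 2 * p * (α / S.mu))) / sigmaMin S.Q * α
      ≤ S.hessianLipConst α := by
  have hκ : 0 ≤ specNorm S.C * specNorm S.B := mul_nonneg (specNorm_nonneg _) (specNorm_nonneg _)
  set π := α / S.mu with hπ
  have hπ0 : 0 ≤ π := by positivity
  set κ := specNorm S.C * specNorm S.B with hκd
  have hM : S.hessianLipConst α = (π / sigmaMin S.Q * α) *
      (κ * (κ * (4 * S.zeta1 α + 2 * S.zeta2 α) + 4 * S.zeta3 α + 2 * S.zeta4 α)) := by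
    rw [hessianLipConst, hκd, hπ]
    field_simp
    ring
  have h3 : S.zeta3 α = 2 * (specNorm S.C ^ 2 * specNorm S.R + κ ^ 2 * π
      + κ * π * S.gamma α * (S.zeta1 α + S.zeta2 α)) / sigmaMin S.Q := by
    rw [zeta3, hκd]; ring
  have h4 : S.zeta4 α = 2 * (specNorm S.C ^ 2 * specNorm S.R + κ ^ 2 * π
      + κ * π * S.gamma α * S.zeta1 α) / sigmaMin S.Q := by
    rw [zeta4, hκd]; ring
  have hq : 6 * (2 * (specNorm S.C ^ 2 * specNorm S.R + κ ^ 2 * π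
      + 2 * (κ * S.gamma α * p * π)) / sigmaMin S.Q) ≤ 4 * S.zeta3 α + 2 * S.zeta4 α := by
    rw [h3, h4]
    clear_value π
    have e : ∀ x y z : ℝ, 12 * x ≤ 8 * y + 4 * z → 6 * (2 * x / sigmaMin S.Q) ≤
        4 * (2 * y / sigmaMin S.Q) + 2 * (2 * z / sigmaMin S.Q) := by
      intro x y z h
      have := div_le_div_of_nonneg_right h hQ.le
      linarith [this, show 12 * x / sigmaMin S.Q = 6 * (2 * x / sigmaMin S.Q) by ring,
        show (8 * y + 4 * z) / sigmaMin S.Q =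
          4 * (2 * y / sigmaMin S.Q) + 2 * (2 * z / sigmaMin S.Q) by ring]
    refine e _ _ _ ?_
    have h5 : 12 * p ≤ 6 * S.zeta1 α + 4 * S.zeta2 α := by linarith
    have := mul_le_mul_of_nonneg_left h5 (show 0 ≤ κ * π * S.gamma α by positivity)
    linarith
  have hp : κ * (6 * p) ≤ κ * (4 * S.zeta1 α + 2 * S.zeta2 α) :=
    mul_le_mul_of_nonneg_left (by linarith) hκ
  rw [hM]
  calc _ = (π / sigmaMin S.Q * α) * (κ * (κ * (6 * p) + 6 * (2 * (specNorm S.C ^ 2 * specNorm S.R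
      + κ ^ 2 * π + 2 * (κ * S.gamma α * p * π)) / sigmaMin S.Q))) := by ring
    _ ≤ _ := by gcongr ?_ * (?_ * ?_); linarith

end Constants

end SOF

/-! ### Derivatives of the value form and of the cost on the sublevel set -/

namespace SOF

variable {n m d : ℕ} {S : SOF n m d}

section Derivatives

variable {P : EuclideanSpace ℝ (Fin m × Fin d) → BilForm (EuclideanSpace ℝ (Fin n))}
  {α : ℝ} {k z e : EuclideanSpace ℝ (Fin m × Fin d)}

/-- The bounds which hold at a gain of the sublevel set. -/
structure IsBounded (S : SOF n m d)
    (P : EuclideanSpace ℝ (Fin m × Fin d) → BilForm (EuclideanSpace ℝ (Fin n))) (α : ℝ)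
    (k : EuclideanSpace ℝ (Fin m × Fin d)) : Prop where
  family : S.IsValueFamily P
  mem : k ∈ S.vecStabilizing
  lyap : IsLyapunov (loopMap (matOp S.A) (matOp S.B) S.feedback k) (P k) (matForm S.Q)
    (matForm S.R) (S.feedback k) (sigmaMin S.Q) (α / S.mu)
  loop_le : ∀ v, ‖loopMap (matOp S.A) (matOp S.B) S.feedback k v‖ ≤ S.gamma α * ‖v‖
  gamma_nonneg : 0 ≤ S.gamma α
  mu_pos : 0 < S.mu
  alpha_pos : 0 < α
  weight_pos : 0 < specNorm S.C ^ 2 * specNorm S.R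
  sigmaR_pos : 0 < sigmaMin S.R
  sigmaR_le : sigmaMin S.R ≤ specNorm S.R
  state_nontrivial : Nontrivial (EuclideanSpace ℝ (Fin n))

namespace IsBounded

lemma pi_pos (h : S.IsBounded P α k) : 0 < α / S.mu := div_pos h.alpha_pos h.mu_pos

lemma first_eq_diag (h : S.IsBounded P α k) (z : EuclideanSpace ℝ (Fin m × Fin d))
    (v : EuclideanSpace ℝ (Fin n)) :
    dirDeriv z P k v v - dirDeriv z P k (loopMap (matOp S.A) (matOp S.B) S.feedback k v)
        (loopMap (matOp S.A) (matOp S.B) S.feedback k v) =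
      2 * (matForm S.R (S.feedback z v) (S.feedback k v) +
        P k (loopDir (matOp S.B) S.feedback z v)
          (loopMap (matOp S.A) (matOp S.B) S.feedback k v)) := by
  rw [h.family.first_eq z k h.mem, h.family.symmR (S.feedback k v) (S.feedback z v),
    h.family.symm k h.mem (loopMap (matOp S.A) (matOp S.B) S.feedback k v)
      (loopDir (matOp S.B) S.feedback z v)]
  ring

lemma zeta1_nonneg (h : S.IsBounded P α k) : 0 ≤ S.zeta1 α := by
  have := h.state_nontrivial
  have hπ := h.pi_pos
  have hc := h.weight_pos
  have h1 := h.lyap.sigma_le_pi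
  rw [zeta1_eq, sub_nonneg, one_le_div h.lyap.pos]
  have : 0 ≤ (specNorm S.C * specNorm S.B) ^ 2 * (α / S.mu) := by positivity
  linarith

lemma first_le_zeta1 (h : S.IsBounded P α k) (hz : ‖z‖ ≤ 1) (v : EuclideanSpace ℝ (Fin n)) :
    |dirDeriv z P k v v| ≤ S.zeta1 α * P k v v := by
  have := h.state_nontrivial
  rw [zeta1_eq]
  exact h.lyap.first_le_amgm (isDirBound hz) h.weight_pos.le (h.first_eq_diag z) v

/-- One third of the balanced bound plus two thirds of the bound through `γ`. As `√(c/σ)` is at most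
half of the balanced bound, the first plus twice the second is at most `2ζ₂`. -/
lemma first_le_zeta2 (h : S.IsBounded P α k) (hz : ‖z‖ ≤ 1) (v : EuclideanSpace ℝ (Fin n)) :
    |dirDeriv z P k v v| ≤ 2 / 3 * S.zeta2 α * P k v v := by
  have := h.state_nontrivial
  have hπ := h.pi_pos
  have hσ := h.lyap.pos
  have hc := h.weight_pos
  have h1 := h.lyap.first_le_sqrt (isDirBound hz) h.weight_pos h.pi_pos (h.first_eq_diag z) v
  have h2 := h.lyap.first_le_gamma (isDirBound hz) h.weight_pos h.pi_pos.le
    (mul_nonneg (specNorm_nonneg _) (specNorm_nonneg _)) h.gamma_nonneg h.loop_le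
    (h.first_eq_diag z) v
  have h3 := S.le_zeta2 h.alpha_pos.le h.mu_pos hσ h.sigmaR_pos h.sigmaR_le
  have h4 : √(specNorm S.C ^ 2 * specNorm S.R / sigmaMin S.Q) ≤
      √((specNorm S.C ^ 2 * specNorm S.R + (specNorm S.C * specNorm S.B) ^ 2 * (α / S.mu))
        * (α / S.mu)) / sigmaMin S.Q := by
    rw [le_div_iff₀ hσ, Real.le_sqrt (by positivity) (by positivity), mul_pow,
      Real.sq_sqrt (by positivity), sq (sigmaMin S.Q), ← mul_assoc, div_mul_cancel₀ _ hσ.ne']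
    refine mul_le_mul ?_ h.lyap.sigma_le_pi hσ.le (by positivity)
    have : 0 ≤ (specNorm S.C * specNorm S.B) ^ 2 * (α / S.mu) := by positivity
    linarith
  rw [mul_div_assoc] at h1 h3
  have h5 := mul_le_mul_of_nonneg_right (show
      2 * (√((specNorm S.C ^ 2 * specNorm S.R + (specNorm S.C * specNorm S.B) ^ 2 * (α / S.mu))
        * (α / S.mu)) / sigmaMin S.Q)
      + 2 * (√(specNorm S.C ^ 2 * specNorm S.R / sigmaMin S.Q)
        + 2 * (specNorm S.C * specNorm S.B * (α / S.mu) * S.gamma α) / sigmaMin S.Q)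
      ≤ 2 * S.zeta2 α by linarith) (h.lyap.psd.nonneg v)
  linarith

/-- A common bound for the first derivatives of the value matrix. -/
noncomputable def rate (S : SOF n m d) (α : ℝ) : ℝ := min (S.zeta1 α) (2 / 3 * S.zeta2 α)

lemma first_le (h : S.IsBounded P α k) (hz : ‖z‖ ≤ 1) (v : EuclideanSpace ℝ (Fin n)) :
    |dirDeriv z P k v v| ≤ rate S α * P k v v := by
  rcases min_choice (S.zeta1 α) (2 / 3 * S.zeta2 α) with hm | hm <;> rw [rate, hm]
  exacts [h.first_le_zeta1 hz v, h.first_le_zeta2 hz v]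

lemma zeta2_nonneg (h : S.IsBounded P α k) : 0 ≤ S.zeta2 α := by
  have h3 := S.le_zeta2 h.alpha_pos.le h.mu_pos h.lyap.pos h.sigmaR_pos h.sigmaR_le
  have hσ := h.lyap.pos
  have hπ := h.pi_pos
  have hγ := h.gamma_nonneg
  have hB := specNorm_nonneg S.B
  have hC := specNorm_nonneg S.C
  refine le_trans ?_ h3
  positivity

lemma rate_nonneg (h : S.IsBounded P α k) : 0 ≤ rate S α :=
  le_min h.zeta1_nonneg (mul_nonneg (by norm_num) h.zeta2_nonneg)

lemma second_le (h : S.IsBounded P α k) (hz : ‖z‖ ≤ 1) (he : ‖e‖ ≤ 1)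
    (v : EuclideanSpace ℝ (Fin n)) :
    |dirDeriv e (dirDeriv z P) k v v| ≤ 2 * (specNorm S.C ^ 2 * specNorm S.R
        + (specNorm S.C * specNorm S.B) ^ 2 * (α / S.mu)
        + 2 * (specNorm S.C * specNorm S.B * S.gamma α * rate S α * (α / S.mu)))
        / sigmaMin S.Q * P k v v := by
  refine h.lyap.second_le (isDirBound hz) (isDirBound he) h.weight_pos.le h.pi_pos.le
    (mul_nonneg (specNorm_nonneg _) (specNorm_nonneg _)) h.rate_nonneg h.gamma_nonneg h.loop_le
    (h.family.first_symm z k h.mem) (h.family.first_symm e k h.mem)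
    (h.first_le hz) (h.first_le he) (fun v => ?_) v
  rw [h.family.second_eq z e k h.mem, h.family.symmR (S.feedback e v) (S.feedback z v),
    h.family.symm k h.mem (loopDir (matOp S.B) S.feedback e v)
      (loopDir (matOp S.B) S.feedback z v),
    h.family.first_symm e k h.mem (loopMap (matOp S.A) (matOp S.B) S.feedback k v)
      (loopDir (matOp S.B) S.feedback z v),
    h.family.first_symm z k h.mem (loopMap (matOp S.A) (matOp S.B) S.feedback k v)
      (loopDir (matOp S.B) S.feedback e v)]
  ring

lemma second_diag_le (h : S.IsBounded P α k) (hz : ‖z‖ ≤ 1) (v : EuclideanSpace ℝ (Fin n)) :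
    |dirDeriv z (dirDeriv z P) k v v| ≤ (2 * (specNorm S.C ^ 2 * specNorm S.R
        + (specNorm S.C * specNorm S.B) ^ 2 * (α / S.mu))
        + 4 * (specNorm S.C * specNorm S.B * S.zeta1 α * (α / S.mu)))
        / sigmaMin S.Q * P k v v := by
  refine h.lyap.second_diag_le (isDirBound hz) h.weight_pos.le h.pi_pos.le
    (mul_nonneg (specNorm_nonneg _) (specNorm_nonneg _)) h.zeta1_nonneg
    (h.family.first_symm z k h.mem) (h.first_le_zeta1 hz) (fun v => ?_) v
  rw [h.family.second_eq z z k h.mem,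
    h.family.first_symm z k h.mem (loopMap (matOp S.A) (matOp S.B) S.feedback k v)
      (loopDir (matOp S.B) S.feedback z v)]
  ring

lemma third_le (h : S.IsBounded P α k) (hz : ‖z‖ ≤ 1) (he : ‖e‖ ≤ 1)
    (v : EuclideanSpace ℝ (Fin n)) :
    |dirDeriv e (dirDeriv z (dirDeriv z P)) k v v| ≤
      (6 * (specNorm S.C * specNorm S.B * (2 * (specNorm S.C ^ 2 * specNorm S.R
        + (specNorm S.C * specNorm S.B) ^ 2 * (α / S.mu)
        + 2 * (specNorm S.C * specNorm S.B * S.gamma α * rate S α * (α / S.mu)))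
        / sigmaMin S.Q) * (α / S.mu))
      + 6 * ((specNorm S.C * specNorm S.B) ^ 2 * rate S α * (α / S.mu)))
        / sigmaMin S.Q * P k v v := by
  have hκ : 0 ≤ specNorm S.C * specNorm S.B := mul_nonneg (specNorm_nonneg _) (specNorm_nonneg _)
  refine h.lyap.third_le (isDirBound hz) (isDirBound he) h.pi_pos.le hκ h.rate_nonneg ?_
    (h.family.first_symm z k h.mem) (h.family.first_symm e k h.mem)
    (h.family.second_symm z z k h.mem) (h.family.second_symm z e k h.mem)
    (h.first_le hz) (h.first_le he) (h.second_le hz hz) (h.second_le hz he)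
    (h.family.third_eq z e k h.mem) v
  have h1 := h.weight_pos
  have h2 := h.pi_pos
  have h3 := h.gamma_nonneg
  have h4 := h.rate_nonneg
  have h5 := h.lyap.pos
  positivity

end IsBounded

end Derivatives

section Cost

variable {P : EuclideanSpace ℝ (Fin m × Fin d) → BilForm (EuclideanSpace ℝ (Fin n))}

/-- The cost as a function of the vector of entries of the gain. -/
noncomputable def vecJ (S : SOF n m d) (k : EuclideanSpace ℝ (Fin m × Fin d)) : ℝ :=
  S.J (unvec m d k)

lemma vecJ_eqOn (hP : S.IsValueFamily P)
    (hD : ∀ i, MemLp (fun x : Fin n → ℝ => x i) 2 S.D) (hQ : S.Q.PosDef) (hR : S.R.PosDef) :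
    Set.EqOn S.vecJ (fun k => S.moment (P k)) S.vecStabilizing :=
  fun _ hk => J_eq_of_isValueFamily hP hD hQ hR hk

lemma contDiffOn_vecJ (hP : S.IsValueFamily P)
    (hD : ∀ i, MemLp (fun x : Fin n → ℝ => x i) 2 S.D) (hQ : S.Q.PosDef) (hR : S.R.PosDef) :
    ContDiffOn ℝ ∞ S.vecJ S.vecStabilizing := by
  refine ContDiffOn.congr (f := fun k => S.moment (P k)) ?_ (vecJ_eqOn hP hD hQ hR)
  exact contDiffOn_const.clm_apply hP.smooth

lemma second_vecJ_eqOn (hP : S.IsValueFamily P)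
    (hD : ∀ i, MemLp (fun x : Fin n → ℝ => x i) 2 S.D) (hQ : S.Q.PosDef) (hR : S.R.PosDef)
    (z e : EuclideanSpace ℝ (Fin m × Fin d)) :
    Set.EqOn (dirDeriv e (dirDeriv z S.vecJ)) (fun k => S.moment (dirDeriv e (dirDeriv z P) k))
      S.vecStabilizing := by
  have h1 := (dirDeriv_congr hP.isOpen (vecJ_eqOn hP hD hQ hR) z).trans
    (dirDeriv_clm_comp hP.smooth hP.isOpen S.moment z)
  exact (dirDeriv_congr hP.isOpen h1 e).trans
    (dirDeriv_clm_comp (hP.smooth.dirDeriv hP.isOpen z) hP.isOpen S.moment e)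

lemma third_vecJ_eqOn (hP : S.IsValueFamily P)
    (hD : ∀ i, MemLp (fun x : Fin n → ℝ => x i) 2 S.D) (hQ : S.Q.PosDef) (hR : S.R.PosDef)
    (z e : EuclideanSpace ℝ (Fin m × Fin d)) :
    Set.EqOn (dirDeriv e (dirDeriv z (dirDeriv z S.vecJ)))
      (fun k => S.moment (dirDeriv e (dirDeriv z (dirDeriv z P)) k)) S.vecStabilizing :=
  (dirDeriv_congr hP.isOpen (second_vecJ_eqOn hP hD hQ hR z z) e).trans
    (dirDeriv_clm_comp ((hP.smooth.dirDeriv hP.isOpen z).dirDeriv hP.isOpen z) hP.isOpen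
      S.moment e)

lemma matrixHessian_isHermitian {F : Matrix (Fin m) (Fin d) ℝ → ℝ}
    {Ω : Set (EuclideanSpace ℝ (Fin m × Fin d))} (hΩ : IsOpen Ω)
    (hF : ContDiffOn ℝ ∞ (fun k => F (unvec m d k)) Ω)
    {k : EuclideanSpace ℝ (Fin m × Fin d)} (hk : k ∈ Ω) :
    (matrixHessian F (unvec m d k)).IsHermitian := by
  ext p q
  rw [Matrix.conjTranspose_apply, matrixHessian_apply, matrixHessian_apply, star_trivial]
  exact hF.dirDeriv_comm hΩ hk _ _

lemma lambdaMin_matrixHessian_mul_le {F : Matrix (Fin m) (Fin d) ℝ → ℝ}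
    {Ω : Set (EuclideanSpace ℝ (Fin m × Fin d))} (hΩ : IsOpen Ω)
    (hF : ContDiffOn ℝ ∞ (fun k => F (unvec m d k)) Ω)
    {k : EuclideanSpace ℝ (Fin m × Fin d)} (hk : k ∈ Ω)
    (z : EuclideanSpace ℝ (Fin m × Fin d)) :
    lambdaMin (matrixHessian F (unvec m d k)) * ‖z‖ ^ 2 ≤
      dirDeriv z (dirDeriv z fun k => F (unvec m d k)) k := by
  refine (lambdaMin_mul_le (matrixHessian_isHermitian hΩ hF hk) z).trans_eq ?_
  rw [← hF.fderiv_fderiv_apply hΩ hk, bilForm_apply_eq_sum, dotProduct]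
  refine Finset.sum_congr rfl fun p _ => ?_
  rw [Matrix.mulVec, dotProduct, Finset.mul_sum]
  refine Finset.sum_congr rfl fun q _ => ?_
  rw [matrixHessian_apply, hF.fderiv_fderiv_apply hΩ hk]
  ring

end Cost

/-- For `r > 0` the number `ρr/(ρ-r)` exceeds `r`, so no point of the ball can be outside the strict
sublevel set. For `r = 0` the ball is the center, where the cost is at most `β < α`. -/
lemma closedBall_subset_of_le_setDist {α β : ℝ} (hβα : β < α)
    {k : EuclideanSpace ℝ (Fin m × Fin d)} (hk : unvec m d k ∈ S.sublevel β) {ρ r : ℝ}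
    (hr0 : 0 ≤ r) (hr : r < ρ)
    (hω : ENNReal.ofReal (ρ * r / (ρ - r)) ≤ setDist (S.sublevel β) (S.strictSublevel α)ᶜ) :
    Metric.closedBall k r ⊆ unvec m d ⁻¹' S.strictSublevel α := by
  intro x hx
  by_contra hnot
  have h1 : setDist (S.sublevel β) (S.strictSublevel α)ᶜ ≤
      ENNReal.ofReal ‖unvec m d k - unvec m d x‖ :=
    iInf₂_le_of_le (unvec m d k) hk (iInf₂_le (unvec m d x) hnot)
  rw [Metric.mem_closedBall, dist_comm, dist_eq_norm] at hx
  rw [← map_sub, norm_unvec] at h1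
  have h2 := (ENNReal.ofReal_le_ofReal_iff (norm_nonneg _)).1 (hω.trans h1)
  rcases hr0.eq_or_lt with h0 | h0
  · rw [← h0] at hx
    have : k = x := sub_eq_zero.1 (norm_le_zero_iff.1 hx)
    exact hnot (this ▸ ⟨hk.1, hk.2.trans_lt hβα⟩)
  · have h3 := h2.trans hx
    rw [div_le_iff₀ (sub_pos.2 hr)] at h3
    nlinarith

end SOF

/-! ### Local linear convergence for static output feedback -/

theorem theorem2 {n m d : ℕ} (S : SOF n m d) [IsProbabilityMeasure S.D]
    (hD : ∀ i, MemLp (fun x : Fin n → ℝ => x i) 2 S.D)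
    (hC : S.C.rank = d) (hQ : S.Q.PosDef) (hR : S.R.PosDef) (hμ : 0 < S.mu)
    (α β : ℝ) (hβα : β < α)
    (Kmin : Matrix (Fin m) (Fin d) ℝ) (hKβ : Kmin ∈ S.sublevel β)
    (hKmin : IsLocalMinOn S.J S.stabilizing Kmin)
    (l : ℝ) (hl : l = lambdaMin (matrixHessian S.J Kmin)) (hl0 : 0 < l)
    (η : ℝ) (hη0 : 0 < η) (hη : η ≤ 1 / S.smoothConst α)
    (K : ℕ → Matrix (Fin m) (Fin d) ℝ)
    (hK : ∀ i, K (i + 1) = K i - η • matrixGradient S.J (K i))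
    (rbar r₀ : ℝ) (hrbar : rbar = 2 * l / S.hessianLipConst α) (hr₀ : r₀ = ‖K 0 - Kmin‖)
    (hr : r₀ < rbar)
    (hω : ENNReal.ofReal (rbar * r₀ / (rbar - r₀)) ≤
      setDist (S.sublevel β) (S.strictSublevel α)ᶜ) :
    ∀ i, K i ∈ S.stabilizing ∧
      ‖K i - Kmin‖ ≤ rbar * r₀ / (rbar - r₀) * (1 / (1 + η * l)) ^ i := by
  have hr₀0 : 0 ≤ r₀ := hr₀ ▸ norm_nonneg _
  -- Division by zero being zero, a nonpositive `M` would make `r̄ ≤ 0`, against `0 ≤ r₀ < r̄`.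
  -- Positivity of `M` in turn excludes `B = 0`, `C = 0` and empty dimensions.
  have hM : 0 < S.hessianLipConst α := by
    by_contra hM
    have : rbar ≤ 0 := hrbar ▸ div_nonpos_of_nonneg_of_nonpos (by linarith) (not_lt.1 hM)
    linarith
  have hB : specNorm S.B ≠ 0 := fun h => by simp [SOF.hessianLipConst, h] at hM
  have hC0 : specNorm S.C ≠ 0 := fun h => by simp [SOF.hessianLipConst, h] at hM
  have hn : 0 < n := by
    by_contra h0
    obtain rfl : n = 0 := by omega
    exact hB (norm_eq_zero.2 (by ext1 v; exact Subsingleton.elim _ _) : ‖matOp S.B‖ = 0)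
  have hm : 0 < m := by
    by_contra h0
    obtain rfl : m = 0 := by omega
    refine hB (norm_eq_zero.2 ?_ : ‖matOp S.B‖ = 0)
    ext1 v
    rw [Subsingleton.elim v 0, map_zero, map_zero]
  -- A positive step below `1/L` already forces `L > 0`.
  have hLpos : 0 < S.smoothConst α := one_div_pos.1 (hη0.trans_le hη)
  have hηL : η * S.smoothConst α ≤ 1 := (le_div_iff₀ hLpos).1 hη
  obtain ⟨P, hP⟩ := S.exists_isValueFamily hQ hR
  obtain ⟨k₀, rfl⟩ := (unvec m d).surjective Kmin
  have hα : 0 < α := by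
    have h1 := SOF.isLyapunov_of_mem_sublevel hP hD hQ hR hμ hn hKβ
    have h2 : 0 ≤ S.J (unvec m d k₀) := by
      rw [SOF.J_eq_of_isValueFamily hP hD hQ hR hKβ.1, S.moment_eq_integral hD]
      exact integral_nonneg fun x => h1.psd.nonneg _
    linarith [hKβ.2]
  have hσR := sigmaMin_pos hR hm
  have hσRle := sigmaMin_le_specNorm hR.posSemidef hm
  have hbdd : ∀ k, unvec m d k ∈ S.sublevel α → S.IsBounded P α k := fun k hk => by
    have hγ := SOF.specNorm_closedLoop_le_gamma hP hD hQ hR hμ hn hm hα.le hk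
    exact
      { family := hP
        mem := hk.1
        lyap := SOF.isLyapunov_of_mem_sublevel hP hD hQ hR hμ hn hk
        loop_le := fun v => by
          rw [SOF.loopMap_feedback]
          exact (norm_matOp_apply_le _ v).trans (mul_le_mul_of_nonneg_right hγ (norm_nonneg v))
        gamma_nonneg := (specNorm_nonneg _).trans hγ
        mu_pos := hμ
        alpha_pos := hα
        weight_pos := mul_pos (by positivity) (hσR.trans_le hσRle)
        sigmaR_pos := hσR
        sigmaR_le := hσRle
        state_nontrivial := by
          have : Nonempty (Fin n) := ⟨⟨0, hn⟩⟩
          infer_instance }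
  have hball := SOF.closedBall_subset_of_le_setDist hβα hKβ hr₀0 hr hω
  have hmem : ∀ k ∈ Metric.closedBall k₀ r₀, unvec m d k ∈ S.sublevel α :=
    fun k hk => ⟨(hball hk).1, (hball hk).2.le⟩
  have hsmooth := SOF.contDiffOn_vecJ hP hD hQ hR
  have hregion : IsDescentRegion S.vecJ S.vecStabilizing k₀ r₀ l (S.smoothConst α)
      (S.hessianLipConst α) :=
    { isOpen := hP.isOpen
      smooth := hsmooth
      subset := fun k hk => (hball hk).1
      crit := fun z => by
        have h1 : IsLocalMin S.J (unvec m d k₀) :=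
          hKmin.isLocalMin (S.isOpen_stabilizing.mem_nhds hKβ.1)
        change dirDeriv z (fun k => S.J (unvec m d k)) k₀ = 0
        rw [dirDeriv_comp_unvec]
        exact DFunLike.congr_fun h1.fderiv_eq_zero (unvec m d z)
      hess_ge := fun z => hl ▸ SOF.lambdaMin_matrixHessian_mul_le hP.isOpen hsmooth hKβ.1 z
      hess_le := fun k hk => second_le_of_le_of_norm_le_one fun z hz => by
        have hb := hbdd k (hmem k hk)
        -- The moment of the value form is the cost, which is at most `α`; this supplies the last
        -- factor `α` of `L`, and likewise of `M` below.
        have h1 := S.abs_moment_le hD (hb.second_diag_le hz)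
        rw [SOF.second_vecJ_eqOn hP hD hQ hR z z hb.mem,
          S.smoothConst_eq (mul_ne_zero hC0 hB)]
        refine (le_abs_self _).trans (h1.trans (mul_le_mul_of_nonneg_left ?_ ?_))
        · rw [← SOF.J_eq_of_isValueFamily hP hD hQ hR hb.mem]
          exact (hmem k hk).2
        · have h2 := hb.weight_pos
          have h3 := hb.pi_pos
          have h4 := hb.zeta1_nonneg
          have h5 := hb.lyap.pos
          have h6 := specNorm_nonneg S.B
          have h7 := specNorm_nonneg S.C
          positivity
      third_le := fun k hk => third_le_of_le_of_norm_le_one fun z e hz he => by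
        have hb := hbdd k (hmem k hk)
        have h1 := S.abs_moment_le hD (hb.third_le hz he)
        rw [SOF.third_vecJ_eqOn hP hD hQ hR z e hb.mem]
        refine (h1.trans (mul_le_mul_of_nonneg_left ?_ ?_)).trans
          (S.le_hessianLipConst hα.le hμ hb.lyap.pos hb.gamma_nonneg hb.rate_nonneg
            (min_le_left _ _) (p := SOF.IsBounded.rate S α) ?_)
        · rw [← SOF.J_eq_of_isValueFamily hP hD hQ hR hb.mem]
          exact (hmem k hk).2
        · have h2 := hb.weight_pos
          have h3 := hb.pi_pos
          have h4 := hb.rate_nonneg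
          have h5 := hb.lyap.pos
          have h6 := specNorm_nonneg S.B
          have h7 := specNorm_nonneg S.C
          have h8 := hb.gamma_nonneg
          positivity
        · have : SOF.IsBounded.rate S α ≤ 2 / 3 * S.zeta2 α := min_le_right _ _
          linarith }
  have hnorm : ∀ i, ‖(unvec m d).symm (K i) - k₀‖ = ‖K i - unvec m d k₀‖ := fun i => by
    rw [← norm_unvec, map_sub, ContinuousLinearEquiv.apply_symm_apply]
  intro i
  have := hregion.iterate_bound hη0 hηL hl0 hM (x := fun i => (unvec m d).symm (K i))
    (fun i w => by
      have h1 := inner_matrixGradient S.J ((unvec m d).symm (K i)) w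
      rw [ContinuousLinearEquiv.apply_symm_apply] at h1
      rw [hK, map_sub, map_smul, inner_sub_right, inner_smul_right, h1]
      rfl)
    (by rw [hnorm, hr₀]) (hrbar ▸ hr) i
  rw [hnorm, ← hrbar] at this
  refine ⟨?_, this.2⟩
  have h1 := (hball this.1).1
  rwa [ContinuousLinearEquiv.apply_symm_apply] at h1
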